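/- Let $N$ be a finite set and let $\mathcal{F}\subseteq 2^N$ be a nonempty down-closed family (if $I\in\mathcal F$ and $J\subseteq I$ then $J\in\mathcal F$). Let $P\subseteq[0,1]^N$ be a relaxation of $\mathcal F$, i.e. a polytope with the same $\{0,1\}$-points as the convex hull of the characteristic vectors of the sets in $\mathcal F$. A (randomized) greedy OCRS for $P$ chooses, for each $x\in P$, a (random) nonempty down-closed family $\mathcal F_x\subseteq\mathcal F$. For $c\in[0,1]$ it is $c$-selectable if for all $x\in P$ and $e\in N$ $$\Pr\bigl[\,I\cup\{e\}\in\mathcal F_x\ \text{ for all } I\subseteq R(x) \text{ with } I\in\mathcal F_x\,\bigr]\ \ge\ c,$$ where $R(x)$ contains each $e\in N$ independently with probability $x_e$ and is independent of the choice of $\mathcal F_x$. Each $e\in N$ is an agent with a valuation $Z_e\ge 0$; the $Z_e$ are independent with known distributions, and exactly the sets in $\mathcal F$ can be served. A (randomized) constrained oblivious posted price mechanism (COPM) for $\mathcal F$ draws, independently of the valuations, a pair $(p,\mathcal F')$ with $p\in\mathbb R_{\ge0}^N$ and $\emptyset\in\mathcal F'\subseteq\mathcal F$. The agents then arrive one by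 one. If $S$ is the set of agents served so far and $e$ arrives, then $e$ is skipped if $S\cup\{e\}\notin\mathcal F'$, and otherwise $e$ is offered the price $p_e$, and is served and pays $p_e$ if and only if $Z_e\ge p_e$. Its expected revenue against the almighty adversary is the expectation of the minimum, over all arrival orders, of the total payment (so the order may depend on all valuations, on $p$ and on $\mathcal F'$). A truthful mechanism for $\mathcal F$ is a (possibly randomized) measurable mechanism that maps nonnegative bids to a random served set in $\mathcal F$ and payments, such that truthful bidding is a dominant strategy for every agent and gives every agent nonnegative utility (in expectation over the coins of the mechanism, for every bid profile). Its expected revenue is the expected total payment under truthful bidding. Theorem. Suppose that there is a $c$-selectable greedy OCRS for $P$. Then for all distributions of the independent valuations, the following hold. 1. For every truthful mechanism $M$ for $\mathcal F$ (in particular for an optimal one, whenever it exists) there is a COPM for $\mathcal F$ whose expected revenue against the almighty adversary is at least $c$ times the expected revenue of $M$. 2. If all expectations $\mathbb E[Z_e]$ are finite, then there is a single COPM for $\mathcal F$ whose expected revenue against the almighty adversary is at least $c$ times the expected revenue of every truthful mechanism for $\mathcal F$, and hence at least $c$ times the supremum of these revenues. -/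

import Mathlib

open MeasureTheory
open scoped ENNReal NNReal

noncomputable section

namespace Pricing

variable {N : Type*} [Fintype N] [DecidableEq N]

/-- A (nonempty) down-closed family of subsets of `N`. -/
def IsDownClosed (F : Finset (Finset N)) : Prop :=
  F.Nonempty ∧ ∀ I ∈ F, ∀ J, J ⊆ I → J ∈ F

/-- The characteristic vector of `S`. -/
def charVec (S : Finset N) : N → ℝ := fun e => if e ∈ S then 1 else 0

/-- The convex hull of the characteristic vectors of the sets in `F`. -/
def feasiblePolytope (F : Finset (Finset N)) : Set (N → ℝ) :=
  convexHull ℝ (charVec '' (F : Set (Finset N)))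

/-- `P` is a polytope contained in the unit cube which has the same 0/1-points as
the convex hull of the characteristic vectors of the sets in `F`. -/
structure IsRelaxation (F : Finset (Finset N)) (P : Set (N → ℝ)) : Prop where
  isPolytope : ∃ V : Set (N → ℝ), V.Finite ∧ P = convexHull ℝ V
  subset_cube : P ⊆ Set.Icc 0 1
  zero_one_points :
    P ∩ {x | ∀ e, x e = 0 ∨ x e = 1} = feasiblePolytope F ∩ {x | ∀ e, x e = 0 ∨ x e = 1}

/-- The probability that `R(x) = R`, where the random set `R(x)` contains each `e`
independently with probability `x e`. -/
def activeProb (x : N → ℝ) (R : Finset N) : ℝ :=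
  (∏ e ∈ R, x e) * ∏ e ∈ Rᶜ, (1 - x e)

/-- A (randomized) greedy online contention resolution scheme for the relaxation `P` of `F`:
for each `x ∈ P`, a distribution over nonempty down-closed subfamilies of `F`. The scheme draws
such a family, independently of the active set, and selects an arriving active element whenever it
can be added to the elements selected before without leaving the family. Deterministic schemes are
those given by point masses. -/
structure GreedyOCRS (F : Finset (Finset N)) (P : Set (N → ℝ)) where
  family : (N → ℝ) → PMF (Finset (Finset N))
  family_subset : ∀ x ∈ P, ∀ G ∈ (family x).support, G ⊆ F
  family_downClosed : ∀ x ∈ P, ∀ G ∈ (family x).support, IsDownClosed G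

/-- `e` can be added to every member of `G` that is contained in `R`. -/
def IsSelectableElement (G : Finset (Finset N)) (R : Finset N) (e : N) : Prop :=
  ∀ I ∈ G, I ⊆ R → insert e I ∈ G

instance (G : Finset (Finset N)) (R : Finset N) (e : N) :
    Decidable (IsSelectableElement G R e) := by
  unfold IsSelectableElement; infer_instance

/-- For all `x ∈ P` and all `e`, the element `e` is selectable with probability at least `c`
over the independent draws of the active set `R(x)` and of the family. -/
def GreedyOCRS.IsSelectable {F : Finset (Finset N)} {P : Set (N → ℝ)}
    (π : GreedyOCRS F P) (c : ℝ) : Prop :=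
  ∀ x ∈ P, ∀ e : N,
    c ≤ ∑ R : Finset N, ∑ G : Finset (Finset N),
      if IsSelectableElement G R e then activeProb x R * (π.family x G).toReal else 0

/-- A (randomized, direct) mechanism. A vector of nonnegative bids is mapped to a distribution over
feasible sets of served agents and to the payment of each agent, in expectation over the random
choices of the mechanism; payments may be negative. -/
structure Mechanism (F : Finset (Finset N)) where
  alloc : (N → ℝ≥0) → PMF (Finset N)
  pay : (N → ℝ≥0) → N → ℝ
  alloc_feasible : ∀ b, ∀ S ∈ (alloc b).support, S ∈ F
  measurable_alloc : ∀ S, Measurable fun b => alloc b S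
  measurable_pay : ∀ e, Measurable fun b => pay b e

/-- The probability that `e` is served under the bids `b`. -/
def Mechanism.serveProb {F : Finset (Finset N)} (M : Mechanism F) (b : N → ℝ≥0) (e : N) : ℝ :=
  ∑ S : Finset N, if e ∈ S then (M.alloc b S).toReal else 0

/-- The expected utility of agent `e` with valuation `v` under the bids `b`. -/
def Mechanism.utility {F : Finset (Finset N)} (M : Mechanism F) (e : N) (v : ℝ≥0)
    (b : N → ℝ≥0) : ℝ :=
  v * M.serveProb b e - M.pay b e

/-- Bidding the true valuation is a dominant strategy of each agent, and a truthful
agent never has negative (expected) utility. -/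
structure Mechanism.IsTruthful {F : Finset (Finset N)} (M : Mechanism F) : Prop where
  incentive_compatible : ∀ (b : N → ℝ≥0) (e : N) (r : ℝ≥0),
    M.utility e (b e) (Function.update b e r) ≤ M.utility e (b e) b
  individually_rational : ∀ (b : N → ℝ≥0) (e : N), 0 ≤ M.utility e (b e) b

/-- The expected total payment when the independent valuations with laws `D e` are bid, as the
difference of the expectations of the positive and the negative part of the total payment
(it is `⊥` if both are infinite, where it would be undefined). -/
def Mechanism.expectedRevenue {F : Finset (Finset N)} (M : Mechanism F)
    (D : N → Measure ℝ≥0) : EReal :=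
  ((∫⁻ v, ENNReal.ofReal (∑ e, M.pay v e) ∂(Measure.pi D) : ℝ≥0∞) : EReal)
    - ((∫⁻ v, ENNReal.ofReal (-∑ e, M.pay v e) ∂(Measure.pi D) : ℝ≥0∞) : EReal)

/-- Agent `e` arrives while `S` is the set of agents served so far: if `insert e S` is in the
family, then `e` is offered the price `p e`, and accepts iff the valuation `z e` is at least that. -/
def serveStep (p : N → ℝ≥0) (G : Finset (Finset N)) (z : N → ℝ≥0) (S : Finset N) (e : N) :
    Finset N :=
  if insert e S ∈ G ∧ p e ≤ z e then insert e S else S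

/-- The set of agents served by the posted prices `p` and the family `G` for the arrival
order `l`. -/
def served (p : N → ℝ≥0) (G : Finset (Finset N)) (z : N → ℝ≥0) (l : List N) : Finset N :=
  l.foldl (serveStep p G z) ∅

/-- The arrival orders of the agents. -/
abbrev ArrivalOrder (N : Type*) := {l : List N // l.Nodup ∧ ∀ e, e ∈ l}

/-- The revenue against the almighty adversary: the valuations, the prices and the family are
all known when the arrival order is chosen. -/
def worstRevenue (p : N → ℝ≥0) (G : Finset (Finset N)) (z : N → ℝ≥0) : ℝ≥0∞ :=
  ⨅ l : ArrivalOrder N, ∑ e ∈ served p G z l.1, (p e : ℝ≥0∞)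

/-- A randomized constrained oblivious posted price mechanism for `F`: the law of the pair of a
price vector and a subfamily of `F` (containing the initial set `∅` of served agents). The
σ-algebra of Mathlib on `Finset (Finset N)` is the discrete one, as `N` is finite. -/
structure RandomizedCOPM (F : Finset (Finset N)) where
  law : Measure ((N → ℝ≥0) × Finset (Finset N))
  isProbabilityMeasure : IsProbabilityMeasure law
  subfamily : ∀ᵐ t ∂law, ∅ ∈ t.2 ∧ t.2 ⊆ F

/-- The expected revenue against the almighty adversary, over the valuations and the independent
random choice of the prices and the family. -/
def RandomizedCOPM.expectedRevenue {F : Finset (Finset N)} (C : RandomizedCOPM F)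
    (D : N → Measure ℝ≥0) : ℝ≥0∞ :=
  ∫⁻ w, worstRevenue w.2.1 w.2.2 w.1 ∂((Measure.pi D).prod C.law)

end Pricing

end

/-!
A posted price mechanism is compared with a truthful one agent by agent, and the contention
resolution scheme turns the comparison of single agents into one of mechanisms.

*Truthful mechanisms are dominated by random prices.* Averaging a truthful mechanism over the bids
of the other agents gives agent `e` a monotone allocation rule `X`, whose payment at `z` is at most
`∫ s in 0..z, (X z - X s)` (`ofReal_pay_le_lintegral`). Drawing a level `θ` uniformly and posting
the infimum of the valuations served with probability at least `θ` implements `X` by a random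
price, once the offer is thinned where `X` jumps (`exists_priceLaw_of_monotone`). So the revenue is at most the sum over the agents of the revenues
of random prices whose sale probabilities `q e` are the serving probabilities of the mechanism, and
`q` is a convex combination of characteristic vectors of feasible sets, hence a point of `P`
(`Mechanism.IsTruthful.exists_priceLaws`). Only the positive part of the payments is used, so no
integrability is needed.

*Posting random prices keeps a `c`-fraction.* Draw the prices independently, and independently of
them a family from the scheme for `q`. The set `R` of agents that accept their price has the law
of `R(q)`. An agent in `R` that can be added to every member of the family inside `R` is served in
every arrival order (`mem_foldl_serveStep`). As the family is down-closed, this selectability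
depends only on the other agents, so it is independent of the agent's own payment and costs at
most a factor `c` (`exists_COPM_of_priceLaws`).

*A single mechanism for finite means.* For one agent, the pairs of sale probability and revenue
attained by a fixed price, offered with some probability, form a compact subset of the plane: the
probability of accepting `t` is left-continuous in `t`, offering with smaller probability fills
the jumps, and the revenue vanishes as `t` tends to infinity (`isCompact_salePoints`). Random prices
attain exactly the convex hull, which is compact too, so the sum of the single-agent revenues has a
maximizer under the constraint that `q` is a convex combination of feasible sets
(`exists_optimal_priceLaws`), and posting the maximizer serves all truthful mechanisms at once.
-/

namespace Pricing

noncomputable section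

/-! ### Monotone allocation rules as random posted prices -/

/-- The probability that an agent with valuation law `D` accepts the price `t`; the price `∞` is
never accepted, so it encodes that no offer is made. -/
def acceptProb (D : Measure ℝ≥0) (t : ℝ≥0∞) : ℝ≥0∞ := D {z | t ≤ (z : ℝ≥0∞)}

/-- The probability that an agent with valuation law `D` buys at a random price with law `ν`. -/
def saleProb (D : Measure ℝ≥0) (ν : Measure ℝ≥0∞) : ℝ≥0∞ := ∫⁻ t, acceptProb D t ∂ν

/-- The expected payment of an agent with valuation law `D` at a random price with law `ν`. -/
def saleRevenue (D : Measure ℝ≥0) (ν : Measure ℝ≥0∞) : ℝ≥0∞ := ∫⁻ t, t * acceptProb D t ∂ν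

theorem acceptProb_top (D : Measure ℝ≥0) : acceptProb D ∞ = 0 := by
  simp [acceptProb]

theorem acceptProb_le_one (D : Measure ℝ≥0) [IsProbabilityMeasure D] (t : ℝ≥0∞) :
    acceptProb D t ≤ 1 := prob_le_one

theorem antitone_acceptProb (D : Measure ℝ≥0) : Antitone (acceptProb D) :=
  fun _ _ h => measure_mono fun _ hz => le_trans h hz

theorem measurable_acceptProb (D : Measure ℝ≥0) : Measurable (acceptProb D) :=
  (antitone_acceptProb D).measurable

/-- The uniform distribution on `(0, 1]`, as a measure on `ℝ≥0∞`. -/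
def unitUniform : Measure ℝ≥0∞ :=
  (volume.restrict (Set.Ioc (0 : ℝ) 1)).map ENNReal.ofReal

theorem unitUniform_Iic {a : ℝ≥0∞} (ha : a ≤ 1) : unitUniform (Set.Iic a) = a := by
  have hfin : a ≠ ∞ := ne_top_of_le_ne_top ENNReal.one_ne_top ha
  have h1 : a.toReal ≤ 1 := by simpa using ENNReal.toReal_mono ENNReal.one_ne_top ha
  have hset : ENNReal.ofReal ⁻¹' Set.Iic a ∩ Set.Ioc (0 : ℝ) 1 = Set.Ioc 0 a.toReal := by
    ext x
    simp only [Set.mem_inter_iff, Set.mem_preimage, Set.mem_Iic, Set.mem_Ioc,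
      ENNReal.ofReal_le_iff_le_toReal hfin]
    constructor
    · rintro ⟨h, h0, -⟩; exact ⟨h0, h⟩
    · rintro ⟨h0, h⟩; exact ⟨h, h0, h.trans h1⟩
  rw [unitUniform, Measure.map_apply ENNReal.measurable_ofReal measurableSet_Iic,
    Measure.restrict_apply (ENNReal.measurable_ofReal measurableSet_Iic), hset, Real.volume_Ioc,
    sub_zero, ENNReal.ofReal_toReal hfin]

instance : IsProbabilityMeasure unitUniform where
  measure_univ := by
    rw [unitUniform, Measure.map_apply ENNReal.measurable_ofReal MeasurableSet.univ]
    simp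

theorem unitUniform_Ioc {a b : ℝ≥0∞} (ha : a ≤ 1) (hba : b ≤ a) :
    unitUniform (Set.Ioc b a) = a - b := by
  have hb : b ≤ 1 := hba.trans ha
  rw [← Set.Iic_sdiff_Iic, measure_sdiff (Set.Iic_subset_Iic.2 hba)
    measurableSet_Iic.nullMeasurableSet (measure_ne_top _ _), unitUniform_Iic ha,
    unitUniform_Iic hb]

/-- The infimum of the valuations that are served with probability at least `θ`. -/
def threshold (X : ℝ≥0 → ℝ≥0∞) (θ : ℝ≥0∞) : ℝ≥0∞ := ⨅ (z : ℝ≥0) (_ : θ ≤ X z), (z : ℝ≥0∞)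

theorem monotone_threshold (X : ℝ≥0 → ℝ≥0∞) : Monotone (threshold X) :=
  fun _ _ h => le_iInf₂ fun z hz => iInf₂_le z (h.trans hz)

theorem coe_le_threshold {X : ℝ≥0 → ℝ≥0∞} (hX : Monotone X) {θ : ℝ≥0∞} {s : ℝ≥0} (h : X s < θ) :
    (s : ℝ≥0∞) ≤ threshold X θ := by
  refine le_iInf₂ fun z hz => ?_
  by_contra! hlt
  exact absurd (hz.trans (hX (ENNReal.coe_le_coe.1 hlt.le))) (not_le.2 h)

/-- The payment identity of a monotone allocation rule, averaged over a uniform level `θ`: the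
integral of `X z - X s` over the lower valuations `s` is at most the mean of the threshold prices
of the levels at which `z` is served. -/
theorem lintegral_sub_le_lintegral_threshold {X : ℝ≥0 → ℝ≥0∞} (hX : Monotone X)
    (hX1 : ∀ z, X z ≤ 1) (z : ℝ≥0) :
    ∫⁻ s in Set.Ioo (0 : ℝ) z, (X z - X s.toNNReal) ≤
      ∫⁻ θ in {θ | θ ≤ X z}, threshold X θ ∂unitUniform := by
  have hmX : Measurable X := hX.measurable
  have hS : MeasurableSet {w : ℝ × ℝ≥0∞ | X w.1.toNNReal < w.2 ∧ w.2 ≤ X z} :=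
    (measurableSet_lt (by fun_prop) measurable_snd).inter
      (measurableSet_le measurable_snd measurable_const)
  calc ∫⁻ s in Set.Ioo (0 : ℝ) z, (X z - X s.toNNReal)
      = ∫⁻ s in Set.Ioo (0 : ℝ) z, ∫⁻ θ,
          Set.indicator {w : ℝ × ℝ≥0∞ | X w.1.toNNReal < w.2 ∧ w.2 ≤ X z} 1 (s, θ)
            ∂unitUniform ∂volume := by
        refine setLIntegral_congr_fun measurableSet_Ioo fun s hs => ?_
        have hsz : s.toNNReal ≤ z := Real.toNNReal_le_iff_le_coe.2 hs.2.le
        change X z - X s.toNNReal = _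
        rw [← unitUniform_Ioc (hX1 z) (hX hsz), ← lintegral_indicator_one measurableSet_Ioc]
        rfl
    _ = ∫⁻ θ, ∫⁻ s in Set.Ioo (0 : ℝ) z,
          Set.indicator {w : ℝ × ℝ≥0∞ | X w.1.toNNReal < w.2 ∧ w.2 ≤ X z} 1 (s, θ)
            ∂volume ∂unitUniform :=
        lintegral_lintegral_swap (measurable_one.indicator hS).aemeasurable
    _ ≤ ∫⁻ θ, Set.indicator {θ | θ ≤ X z} (threshold X) θ ∂unitUniform := by
        refine lintegral_mono fun θ => ?_
        by_cases hθ : θ ≤ X z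
        · rw [Set.indicator_of_mem (show θ ∈ {θ | θ ≤ X z} from hθ)]
          have hfin : threshold X θ ≠ ∞ := ne_top_of_le_ne_top ENNReal.coe_ne_top (iInf₂_le z hθ)
          calc _ ≤ ∫⁻ s in Set.Ioo (0 : ℝ) z,
                Set.indicator (Set.Icc 0 (threshold X θ).toReal) (1 : ℝ → ℝ≥0∞) s := by
                refine setLIntegral_mono' measurableSet_Ioo fun s hs => ?_
                by_cases hw : X s.toNNReal < θ
                · have hmem : s ∈ Set.Icc 0 (threshold X θ).toReal := by
                    refine ⟨hs.1.le, ?_⟩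
                    have := ENNReal.toReal_mono hfin (coe_le_threshold hX hw)
                    simpa [hs.1.le] using this
                  rw [Set.indicator_of_mem hmem]
                  exact Set.indicator_le_self' (fun _ _ => zero_le) _
                · rw [Set.indicator_of_notMem fun h => hw h.1]
                  exact zero_le
            _ ≤ ∫⁻ s, Set.indicator (Set.Icc 0 (threshold X θ).toReal) (1 : ℝ → ℝ≥0∞) s :=
                setLIntegral_le_lintegral _ _
            _ = threshold X θ := by
                rw [lintegral_indicator_one measurableSet_Icc, Real.volume_Icc, sub_zero,
                  ENNReal.ofReal_toReal hfin]
        · rw [Set.indicator_of_notMem (show θ ∉ {θ | θ ≤ X z} from hθ)]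
          refine le_of_eq ((lintegral_congr fun s => ?_).trans lintegral_zero)
          exact Set.indicator_of_notMem (fun h => hθ h.2) _
    _ = _ := lintegral_indicator (measurableSet_le measurable_id measurable_const) _

/-- A monotone single-agent allocation rule is implemented by a random posted price that sells with
the same probability and earns at least the payments of the payment identity.

The price is the threshold of a uniformly random level `θ`. If `X` jumps above `θ` only to the
right of the threshold, then posting the threshold would also sell to an agent whose valuation
equals it; the price is therefore offered only with the conditional probability
`D {z | θ ≤ X z} / D {z | threshold X θ ≤ z}` that the rule serves an accepting agent. -/
theorem exists_priceLaw_of_monotone (D : Measure ℝ≥0) [IsProbabilityMeasure D]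
    {X : ℝ≥0 → ℝ≥0∞} (hX : Monotone X) (hX1 : ∀ z, X z ≤ 1) :
    ∃ ν : Measure ℝ≥0∞, IsProbabilityMeasure ν ∧ saleProb D ν = ∫⁻ z, X z ∂D ∧
      ∫⁻ z, (∫⁻ s in Set.Ioo (0 : ℝ) z, (X z - X s.toNNReal)) ∂D ≤ saleRevenue D ν := by
  have hmX : Measurable X := hX.measurable
  have hmt : Measurable (threshold X) := (monotone_threshold X).measurable
  -- `m θ` is the probability that the rule serves at level `θ`.
  let m : ℝ≥0∞ → ℝ≥0∞ := fun θ => D {z | θ ≤ X z}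
  have hmm : Measurable m :=
    Antitone.measurable fun a b h => measure_mono fun z hz => le_trans h hz
  have hm_le : ∀ θ, m θ ≤ acceptProb D (threshold X θ) :=
    fun θ => measure_mono fun z (hz : θ ≤ X z) =>
      show threshold X θ ≤ z from iInf₂_le z hz
  let ρ : ℝ≥0∞ → ℝ≥0∞ := fun θ => m θ / acceptProb D (threshold X θ)
  have hmρ : Measurable ρ := hmm.div ((measurable_acceptProb D).comp hmt)
  have hρ1 : ∀ θ, ρ θ ≤ 1 := fun θ => ENNReal.div_le_of_le_mul (by simpa using hm_le θ)
  have hρ : ∀ θ, ρ θ * acceptProb D (threshold X θ) = m θ := by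
    intro θ
    by_cases h0 : acceptProb D (threshold X θ) = 0
    · have : m θ = 0 := le_antisymm (h0 ▸ hm_le θ) zero_le
      rw [h0, mul_zero, this]
    · exact ENNReal.div_mul_cancel h0 (measure_ne_top _ _)
  -- The mass that the thinning removes is moved to the price `∞`, which never sells.
  let ν₁ : Measure ℝ≥0∞ := (unitUniform.withDensity ρ).map (threshold X)
  have hν₁ : ν₁ Set.univ ≤ 1 := by
    rw [Measure.map_apply hmt MeasurableSet.univ, Set.preimage_univ,
      withDensity_apply _ MeasurableSet.univ, setLIntegral_univ]
    calc ∫⁻ θ, ρ θ ∂unitUniform ≤ ∫⁻ _, 1 ∂unitUniform := lintegral_mono hρ1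
      _ = 1 := by simp
  have hint : ∀ f : ℝ≥0∞ → ℝ≥0∞, Measurable f → f ∞ = 0 →
      ∫⁻ t, f t ∂(ν₁ + (1 - ν₁ Set.univ) • Measure.dirac ∞) =
        ∫⁻ θ, ρ θ * f (threshold X θ) ∂unitUniform := by
    intro f hf h0
    rw [lintegral_add_measure, lintegral_smul_measure, lintegral_dirac' _ hf, h0, smul_zero,
      add_zero, lintegral_map hf hmt]
    exact lintegral_withDensity_eq_lintegral_mul _ hmρ (hf.comp hmt)
  have hS : MeasurableSet {w : ℝ≥0∞ × ℝ≥0 | w.1 ≤ X w.2} :=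
    measurableSet_le measurable_fst (hmX.comp measurable_snd)
  have hslice : ∀ f : ℝ≥0∞ → ℝ≥0∞, Measurable f →
      ∫⁻ θ, f θ * m θ ∂unitUniform = ∫⁻ z, ∫⁻ θ in {θ | θ ≤ X z}, f θ ∂unitUniform ∂D := by
    intro f hf
    calc ∫⁻ θ, f θ * m θ ∂unitUniform
        = ∫⁻ θ, ∫⁻ z, Set.indicator {w : ℝ≥0∞ × ℝ≥0 | w.1 ≤ X w.2} (fun w => f w.1) (θ, z)
            ∂D ∂unitUniform := by
          refine lintegral_congr fun θ => ?_
          have : MeasurableSet {z | θ ≤ X z} := measurableSet_le measurable_const hmX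
          rw [← lintegral_indicator_const this (f θ)]
          rfl
      _ = ∫⁻ z, ∫⁻ θ, Set.indicator {w : ℝ≥0∞ × ℝ≥0 | w.1 ≤ X w.2} (fun w => f w.1) (θ, z)
            ∂unitUniform ∂D :=
          lintegral_lintegral_swap ((hf.comp measurable_fst).indicator hS).aemeasurable
      _ = _ := by
          refine lintegral_congr fun z => ?_
          rw [← lintegral_indicator (show MeasurableSet {θ | θ ≤ X z} from measurableSet_Iic)]
          rfl
  refine ⟨ν₁ + (1 - ν₁ Set.univ) • Measure.dirac ∞, ⟨?_⟩, ?_, ?_⟩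
  · simp [add_tsub_cancel_of_le hν₁]
  · rw [saleProb, hint _ (measurable_acceptProb D) (acceptProb_top D)]
    calc ∫⁻ θ, ρ θ * acceptProb D (threshold X θ) ∂unitUniform
        = ∫⁻ θ, 1 * m θ ∂unitUniform := by simp only [hρ, one_mul]
      _ = ∫⁻ z, ∫⁻ θ in {θ | θ ≤ X z}, 1 ∂unitUniform ∂D := hslice _ measurable_const
      _ = ∫⁻ z, X z ∂D := by
          refine lintegral_congr fun z => ?_
          rw [setLIntegral_one]
          exact unitUniform_Iic (hX1 z)
  · rw [saleRevenue, hint (fun t => t * acceptProb D t)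
      (measurable_id.mul (measurable_acceptProb D)) (by simp [acceptProb_top])]
    calc _ ≤ ∫⁻ z, ∫⁻ θ in {θ | θ ≤ X z}, threshold X θ ∂unitUniform ∂D :=
          lintegral_mono fun z => lintegral_sub_le_lintegral_threshold hX hX1 z
      _ = ∫⁻ θ, threshold X θ * m θ ∂unitUniform := (hslice _ hmt).symm
      _ = _ := by
          refine lintegral_congr fun θ => ?_
          rw [← hρ θ]
          ring

/-! ### Truthful mechanisms -/

/-- One coordinate of a product measure can be resampled. -/
theorem lintegral_pi_eq_lintegral_update {N : Type*} [Fintype N] [DecidableEq N] {Y : Type*}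
    [MeasurableSpace Y] (μ : N → Measure Y) [∀ i, IsProbabilityMeasure (μ i)] (e : N)
    {f : (N → Y) → ℝ≥0∞} (hf : Measurable f) :
    ∫⁻ x, f x ∂Measure.pi μ = ∫⁻ y, ∫⁻ x, f (Function.update x e y) ∂Measure.pi μ ∂μ e := by
  have hmu : Measurable fun w : (N → Y) × Y => Function.update w.1 e w.2 := measurable_update'
  have hg : Measurable fun x => ∫⁻ y, f (Function.update x e y) ∂μ e :=
    (hf.comp hmu).lintegral_prod_right'
  calc ∫⁻ x, f x ∂Measure.pi μ = ∫⁻ x, ∫⁻ y, f (Function.update x e y) ∂μ e ∂Measure.pi μ := by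
        refine lintegral_eq_of_lmarginal_eq {e} hf hg ?_
        rw [lmarginal_singleton, lmarginal_singleton]
        simp
    _ = _ := lintegral_lintegral_swap (hf.comp hmu).aemeasurable

/-- A truthful single-agent rule serves higher valuations with higher probability. -/
theorem monotone_of_incentiveCompatible {x p : ℝ≥0 → ℝ}
    (hIC : ∀ s r : ℝ≥0, s * x r - p r ≤ s * x s - p s) : Monotone x := by
  intro r s h
  rcases h.eq_or_lt with rfl | h
  · exact le_rfl
  · have h1 := hIC s r
    have h2 := hIC r s
    have h3 : (r : ℝ) < s := NNReal.coe_lt_coe.2 h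
    nlinarith

/-- The utility of a truthful agent with valuation `z` is at least the integral of the serving
probabilities up to `z`. Incentive compatibility bounds the increments of the utility below by a
lower Riemann sum, which by monotonicity differs from the integral by at most one cell. -/
theorem integral_le_utility {x p : ℝ≥0 → ℝ}
    (hIC : ∀ s r : ℝ≥0, s * x r - p r ≤ s * x s - p s) (hIR : p 0 ≤ 0)
    (hx0 : ∀ s, 0 ≤ x s) (hx1 : ∀ s, x s ≤ 1) (z : ℝ≥0) :
    ∫ s in (0 : ℝ)..z, x s.toNNReal ≤ z * x z - p z := by
  have hmono := monotone_of_incentiveCompatible hIC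
  have key : ∀ n : ℕ, ∫ s in (0 : ℝ)..z, x s.toNNReal ≤ z * x z - p z + z * (1 / (n + 1)) := by
    intro n
    set h : ℝ≥0 := z / (n + 1) with hh
    have hn : (0 : ℝ) < n + 1 := by positivity
    have hz : (h : ℝ) * (n + 1) = z := by
      rw [hh]; push_cast; field_simp
    have hcast : ∀ i : ℕ, ((h : ℝ) * i).toNNReal = h * i := fun i => by
      rw [← NNReal.coe_natCast, ← NNReal.coe_mul, Real.toNNReal_coe]
    -- An agent with valuation `h * (i + 1)` does not gain by bidding `h * i`.
    have hincr : ∀ i : ℕ, h * x (h * i) ≤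
        (((h * (i + 1 : ℕ) : ℝ≥0) : ℝ) * x (h * (i + 1 : ℕ)) - p (h * (i + 1 : ℕ))) -
          (((h * i : ℝ≥0) : ℝ) * x (h * i) - p (h * i)) := by
      intro i
      have := hIC (h * (i + 1 : ℕ)) (h * i)
      have hc : ((h * (i + 1 : ℕ) : ℝ≥0) : ℝ) = ((h * i : ℝ≥0) : ℝ) + h := by push_cast; ring
      rw [hc] at this ⊢
      linarith
    have hsum : ∑ i ∈ Finset.range (n + 1), h * x (h * i) ≤ z * x z - p z := by
      refine (Finset.sum_le_sum fun i _ => hincr i).trans ?_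
      rw [Finset.sum_range_sub fun i : ℕ => ((h * i : ℝ≥0) : ℝ) * x (h * i) - p (h * i)]
      have : h * (n + 1 : ℕ) = z := by
        apply NNReal.coe_injective; push_cast; exact hz
      rw [this]
      simp only [Nat.cast_zero, mul_zero, NNReal.coe_zero, zero_mul]
      linarith
    have hfmono : Monotone fun y : ℝ => x (((h : ℝ) * y).toNNReal) := fun a b hab =>
      hmono (Real.toNNReal_mono (mul_le_mul_of_nonneg_left hab h.2))
    have hint := MonotoneOn.integral_le_sum (x₀ := 0) (a := n + 1)
      (hfmono.monotoneOn (Set.Icc (0 : ℝ) (0 + ((n + 1 : ℕ) : ℝ))))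
    simp only [zero_add, hcast] at hint
    have hsub := intervalIntegral.mul_integral_comp_mul_left (a := 0) (b := ((n + 1 : ℕ) : ℝ))
      (f := fun s : ℝ => x s.toNNReal) (h : ℝ)
    have hz' : (h : ℝ) * ((n + 1 : ℕ) : ℝ) = z := by push_cast; exact hz
    rw [mul_zero, hz'] at hsub
    have hshift : ∑ i ∈ Finset.range (n + 1), x (h * (i + 1 : ℕ)) =
        ∑ i ∈ Finset.range (n + 1), x (h * i) + (x (h * (n + 1 : ℕ)) - x (h * (0 : ℕ))) := by
      rw [← Finset.sum_range_sub (fun i : ℕ => x (h * i)), ← Finset.sum_add_distrib]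
      exact Finset.sum_congr rfl fun i _ => by ring
    rw [hshift] at hint
    rw [← Finset.mul_sum] at hsum
    have hhn : (h : ℝ) = z * (1 / (n + 1)) := by rw [← hz]; field_simp
    rw [← hsub, ← hhn]
    have h1 := hx1 (h * (n + 1 : ℕ))
    have h0 := hx0 (h * (0 : ℕ))
    have := mul_le_mul_of_nonneg_left hint h.2
    have h3 : (h : ℝ) * (x (h * (n + 1 : ℕ)) - x (h * (0 : ℕ))) ≤ h * 1 :=
      mul_le_mul_of_nonneg_left (by linarith) h.2
    change (h : ℝ) * _ ≤ (h : ℝ) * _ at this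
    rw [mul_add] at this
    linarith
  have hlim : Filter.Tendsto (fun n : ℕ => z * x z - p z + (z : ℝ) * (1 / ((n : ℝ) + 1)))
      Filter.atTop (nhds (z * x z - p z + (z : ℝ) * 0)) :=
    (tendsto_one_div_add_atTop_nhds_zero_nat.const_mul _).const_add _
  rw [mul_zero, add_zero] at hlim
  exact ge_of_tendsto' hlim key

/-- The payment of a truthful single-agent rule is at most that of the payment identity. -/
theorem ofReal_pay_le_lintegral {x p : ℝ≥0 → ℝ}
    (hIC : ∀ s r : ℝ≥0, s * x r - p r ≤ s * x s - p s) (hIR : p 0 ≤ 0)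
    (hx0 : ∀ s, 0 ≤ x s) (hx1 : ∀ s, x s ≤ 1) (z : ℝ≥0) :
    ENNReal.ofReal (p z) ≤
      ∫⁻ s in Set.Ioo (0 : ℝ) z, (ENNReal.ofReal (x z) - ENNReal.ofReal (x s.toNNReal)) := by
  have hmono := monotone_of_incentiveCompatible hIC
  have hmono' : Monotone fun s : ℝ => x s.toNNReal := fun _ _ h => hmono (Real.toNNReal_mono h)
  have hi : IntervalIntegrable (fun s : ℝ => x s.toNNReal) volume 0 z :=
    hmono'.intervalIntegrable
  have hu := integral_le_utility hIC hIR hx0 hx1 z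
  have hval : p z ≤ ∫ s in Set.Ioo (0 : ℝ) z, (x z - x s.toNNReal) := by
    rw [← integral_Ioc_eq_integral_Ioo, ← intervalIntegral.integral_of_le z.coe_nonneg,
      intervalIntegral.integral_sub intervalIntegrable_const hi, intervalIntegral.integral_const,
      smul_eq_mul, sub_zero]
    linarith
  have hint : IntegrableOn (fun s : ℝ => x z - x s.toNNReal) (Set.Ioo (0 : ℝ) z) := by
    rw [← integrableOn_Ioc_iff_integrableOn_Ioo,
      ← intervalIntegrable_iff_integrableOn_Ioc_of_le z.coe_nonneg]
    exact intervalIntegrable_const.sub hi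
  refine (ENNReal.ofReal_le_ofReal hval).trans (le_of_eq ?_)
  rw [ofReal_integral_eq_lintegral_ofReal hint]
  · exact lintegral_congr fun s => ENNReal.ofReal_sub _ (hx0 _)
  · refine (ae_restrict_mem measurableSet_Ioo).mono fun s hs => sub_nonneg.2 (hmono ?_)
    exact Real.toNNReal_le_iff_le_coe.2 hs.2.le

/-- The bound of the payment identity is preserved when a random rule is averaged. -/
theorem lintegral_pay_le_lintegral_sub {Ω : Type*} [MeasurableSpace Ω] (κ : Measure Ω)
    [IsProbabilityMeasure κ] {x : Ω → ℝ≥0 → ℝ≥0∞}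
    (hx : Measurable fun w : Ω × ℝ≥0 => x w.1 w.2) (hmono : ∀ v, Monotone (x v))
    (hx1 : ∀ v s, x v s ≤ 1) {p : Ω → ℝ≥0∞} {z : ℝ≥0}
    (hp : ∀ v, p v ≤ ∫⁻ s in Set.Ioo (0 : ℝ) z, (x v z - x v s.toNNReal)) :
    ∫⁻ v, p v ∂κ ≤
      ∫⁻ s in Set.Ioo (0 : ℝ) z, (∫⁻ v, x v z ∂κ - ∫⁻ v, x v s.toNNReal ∂κ) := by
  have hxs : ∀ s, Measurable fun v => x v s := fun s =>
    hx.comp (f := fun v : Ω => (v, s)) (by fun_prop)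
  have hdiff : Measurable fun w : Ω × ℝ => x w.1 z - x w.1 w.2.toNNReal :=
    ((hxs z).comp measurable_fst).sub
      (hx.comp (f := fun w : Ω × ℝ => (w.1, w.2.toNNReal)) (by fun_prop))
  refine (lintegral_mono hp).trans (le_of_eq ?_)
  rw [lintegral_lintegral_swap hdiff.aemeasurable]
  refine setLIntegral_congr_fun measurableSet_Ioo fun s hs => ?_
  have hfin : ∫⁻ v, x v s.toNNReal ∂κ ≠ ∞ := by
    refine ne_top_of_le_ne_top ENNReal.one_ne_top ?_
    calc ∫⁻ v, x v s.toNNReal ∂κ ≤ ∫⁻ _, 1 ∂κ := lintegral_mono fun v => hx1 v _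
      _ = 1 := by simp
  exact lintegral_sub (hxs _) hfin
    (Filter.Eventually.of_forall fun v => hmono v (Real.toNNReal_le_iff_le_coe.2 hs.2.le))

variable {N : Type*} [Fintype N] [DecidableEq N] {F : Finset (Finset N)}

theorem Mechanism.serveProb_nonneg (M : Mechanism F) (b : N → ℝ≥0) (e : N) :
    0 ≤ M.serveProb b e :=
  Finset.sum_nonneg fun S _ => by split_ifs <;> simp

theorem sum_pmf_toReal {α : Type*} [Fintype α] (p : PMF α) : ∑ a, (p a).toReal = 1 := by
  rw [← ENNReal.toReal_sum fun a _ => p.apply_ne_top a, ← tsum_fintype (L := .unconditional _),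
    p.tsum_coe, ENNReal.toReal_one]

theorem Mechanism.serveProb_le_one (M : Mechanism F) (b : N → ℝ≥0) (e : N) :
    M.serveProb b e ≤ 1 := by
  rw [← sum_pmf_toReal (M.alloc b)]
  exact Finset.sum_le_sum fun S _ => by split_ifs <;> simp

theorem Mechanism.measurable_serveProb (M : Mechanism F) (e : N) :
    Measurable fun b => M.serveProb b e :=
  Finset.measurable_sum _ fun S _ => by
    by_cases h : e ∈ S
    · simpa only [h, if_true] using (M.measurable_alloc S).ennreal_toReal
    · simpa only [h, if_false] using measurable_const

/-- Each agent of a truthful mechanism can be replaced by a random posted price that sells with the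
probability with which the mechanism serves the agent, and earns at least the expectation of the
positive part of the agent's payment: the bids of the other agents are averaged out. -/
theorem Mechanism.IsTruthful.exists_priceLaw {M : Mechanism F} (hM : M.IsTruthful)
    (D : N → Measure ℝ≥0) [∀ e, IsProbabilityMeasure (D e)] (e : N) :
    ∃ ν : Measure ℝ≥0∞, IsProbabilityMeasure ν ∧
      saleProb (D e) ν = ∫⁻ v, ENNReal.ofReal (M.serveProb v e) ∂Measure.pi D ∧
      ∫⁻ v, ENNReal.ofReal (M.pay v e) ∂Measure.pi D ≤ saleRevenue (D e) ν := by
  have hmu : Measurable fun w : (N → ℝ≥0) × ℝ≥0 => Function.update w.1 e w.2 := measurable_update'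
  let x : (N → ℝ≥0) → ℝ≥0 → ℝ≥0∞ := fun v s =>
    ENNReal.ofReal (M.serveProb (Function.update v e s) e)
  have hmx : Measurable fun w : (N → ℝ≥0) × ℝ≥0 => x w.1 w.2 :=
    ((M.measurable_serveProb e).comp hmu).ennreal_ofReal
  have hIC : ∀ (v : N → ℝ≥0) (s r : ℝ≥0),
      s * M.serveProb (Function.update v e r) e - M.pay (Function.update v e r) e ≤
        s * M.serveProb (Function.update v e s) e - M.pay (Function.update v e s) e := by
    intro v s r
    simpa [Mechanism.utility] using hM.incentive_compatible (Function.update v e s) e r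
  have hIR : ∀ v : N → ℝ≥0, M.pay (Function.update v e 0) e ≤ 0 := by
    intro v
    simpa [Mechanism.utility] using hM.individually_rational (Function.update v e 0) e
  have hx1 : ∀ v s, x v s ≤ 1 := fun v s => by
    simpa [x] using M.serveProb_le_one (Function.update v e s) e
  have hxmono : ∀ v, Monotone (x v) := fun v r s h => ENNReal.ofReal_le_ofReal
    (monotone_of_incentiveCompatible (x := fun s => M.serveProb (Function.update v e s) e)
      (hIC v) h)
  let X : ℝ≥0 → ℝ≥0∞ := fun s => ∫⁻ v, x v s ∂Measure.pi D
  have hX1 : ∀ s, X s ≤ 1 := fun s => by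
    calc X s ≤ ∫⁻ _, 1 ∂Measure.pi D := lintegral_mono fun v => hx1 v s
      _ = 1 := by simp
  obtain ⟨ν, hν, hsale, hrev⟩ := exists_priceLaw_of_monotone (D e) (X := X)
    (fun r s h => lintegral_mono fun v => hxmono v h) hX1
  refine ⟨ν, hν, ?_, le_trans ?_ hrev⟩
  · rw [hsale, lintegral_pi_eq_lintegral_update D e (M.measurable_serveProb e).ennreal_ofReal]
  · rw [lintegral_pi_eq_lintegral_update D e (M.measurable_pay e).ennreal_ofReal]
    refine lintegral_mono fun z => ?_
    exact lintegral_pay_le_lintegral_sub (Measure.pi D) hmx hxmono hx1 fun v =>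
      ofReal_pay_le_lintegral (hIC v) (hIR v) (fun _ => M.serveProb_nonneg _ _)
        (fun _ => M.serveProb_le_one _ _) z

theorem Mechanism.expectedRevenue_le_sum {N : Type*} [Fintype N] {F : Finset (Finset N)}
    (M : Mechanism F) (D : N → Measure ℝ≥0) :
    M.expectedRevenue D ≤
      ((∑ e, ∫⁻ v, ENNReal.ofReal (M.pay v e) ∂Measure.pi D : ℝ≥0∞) : EReal) := by
  rw [Mechanism.expectedRevenue]
  -- The negative part of the payments is dropped.
  refine le_trans (EReal.sub_le_sub le_rfl (EReal.coe_ennreal_nonneg _)) ?_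
  rw [sub_zero, EReal.coe_ennreal_le_coe_ennreal_iff,
    ← lintegral_finsetSum _ fun e _ => (M.measurable_pay e).ennreal_ofReal]
  exact lintegral_mono fun v => Finset.le_sum_of_subadditive _ ENNReal.ofReal_zero.le
    (fun _ _ => ENNReal.ofReal_add_le) _ _

/-- The serving probabilities of a mechanism form a convex combination of feasible sets. -/
theorem Mechanism.expectedServeProb_mem (M : Mechanism F) (D : N → Measure ℝ≥0)
    [∀ e, IsProbabilityMeasure (D e)] :
    (fun e => (∫⁻ v, ENNReal.ofReal (M.serveProb v e) ∂Measure.pi D).toReal) ∈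
      feasiblePolytope F := by
  let w : Finset N → ℝ≥0∞ := fun S => ∫⁻ v, M.alloc v S ∂Measure.pi D
  have hw1 : ∑ S, w S = 1 := by
    rw [← lintegral_finsetSum _ fun S _ => M.measurable_alloc S]
    have : ∀ v, ∑ S, M.alloc v S = 1 := fun v => by
      rw [← tsum_fintype (L := .unconditional _), (M.alloc v).tsum_coe]
    simp [this]
  have hwfin : ∀ S, w S ≠ ∞ := fun S =>
    ne_top_of_le_ne_top ENNReal.one_ne_top
      (hw1 ▸ Finset.single_le_sum (fun _ _ => zero_le) (Finset.mem_univ S))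
  have hwF : ∀ S, S ∉ F → w S = 0 := fun S hS => by
    have : ∀ v, M.alloc v S = 0 := fun v => by
      by_contra h
      exact hS (M.alloc_feasible v S ((PMF.mem_support_iff _ _).2 h))
    simp [w, this]
  have hq : (fun e => (∫⁻ v, ENNReal.ofReal (M.serveProb v e) ∂Measure.pi D).toReal) =
      ∑ S ∈ F, (w S).toReal • charVec S := by
    ext e
    have h1 : ∀ v, ENNReal.ofReal (M.serveProb v e) =
        ∑ S, if e ∈ S then M.alloc v S else 0 := fun v => by
      rw [Mechanism.serveProb, ENNReal.ofReal_sum_of_nonneg fun S _ => by split_ifs <;> simp]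
      refine Finset.sum_congr rfl fun S _ => ?_
      split_ifs <;> simp [PMF.apply_ne_top]
    have h2 : ∫⁻ v, ENNReal.ofReal (M.serveProb v e) ∂Measure.pi D =
        ∑ S, if e ∈ S then w S else 0 := by
      simp only [h1]
      rw [lintegral_finsetSum _ fun S _ => by
        by_cases h : e ∈ S
        · simpa only [h, if_true] using M.measurable_alloc S
        · simpa only [h, if_false] using measurable_const]
      refine Finset.sum_congr rfl fun S _ => ?_
      by_cases h : e ∈ S <;> simp [h, w]
    rw [h2, ENNReal.toReal_sum fun S _ => by split_ifs <;> simp [hwfin S], Finset.sum_apply]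
    rw [← Finset.sum_subset (Finset.subset_univ F) fun S _ hS => by simp [hwF S hS]]
    refine Finset.sum_congr rfl fun S _ => ?_
    by_cases h : e ∈ S <;> simp [h, charVec]
  rw [hq]
  refine (convex_convexHull ℝ _).sum_mem (fun S _ => ENNReal.toReal_nonneg) ?_
    fun S hS => subset_convexHull ℝ _ ⟨S, hS, rfl⟩
  rw [Finset.sum_subset (Finset.subset_univ F) fun S _ hS => by simp [hwF S hS],
    ← ENNReal.toReal_sum fun S _ => hwfin S, hw1, ENNReal.toReal_one]

/-! ### Posting random prices along a greedy contention resolution scheme -/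

/-- The agents that accept their price. -/
def acceptSet (p : N → ℝ≥0) (z : N → ℝ≥0) : Finset N := Finset.univ.filter fun e => p e ≤ z e

theorem subset_serveStep {N : Type*} [DecidableEq N] (p : N → ℝ≥0) (G : Finset (Finset N))
    (z : N → ℝ≥0) (S : Finset N) (e : N) : S ⊆ serveStep p G z S e := by
  unfold serveStep
  split_ifs
  · exact Finset.subset_insert e S
  · exact subset_rfl

theorem subset_foldl_serveStep {N : Type*} [DecidableEq N] (p : N → ℝ≥0) (G : Finset (Finset N))
    (z : N → ℝ≥0) (l : List N) (S : Finset N) : S ⊆ l.foldl (serveStep p G z) S := by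
  induction l generalizing S with
  | nil => exact subset_rfl
  | cons a l ih => exact (subset_serveStep p G z S a).trans (ih _)

theorem serveStep_mem {p : N → ℝ≥0} {G : Finset (Finset N)} {z : N → ℝ≥0} {S : Finset N}
    (hS : S ∈ G) (hSR : S ⊆ acceptSet p z) (e : N) :
    serveStep p G z S e ∈ G ∧ serveStep p G z S e ⊆ acceptSet p z := by
  unfold serveStep
  split_ifs with h
  · exact ⟨h.1, Finset.insert_subset (by simpa [acceptSet] using h.2) hSR⟩
  · exact ⟨hS, hSR⟩

/-- An accepting agent that is selectable with respect to all accepting agents is served, whatever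
the arrival order is: when it arrives, the agents served so far form a member of the family that
consists of accepting agents. -/
theorem mem_foldl_serveStep {p : N → ℝ≥0} {G : Finset (Finset N)} {z : N → ℝ≥0} {e : N}
    (he : e ∈ acceptSet p z) (hsel : IsSelectableElement G (acceptSet p z) e) (l : List N)
    (hl : e ∈ l) (S : Finset N) (hS : S ∈ G) (hSR : S ⊆ acceptSet p z) :
    e ∈ l.foldl (serveStep p G z) S := by
  induction l generalizing S with
  | nil => simp at hl
  | cons a l ih =>
    rw [List.foldl_cons]
    by_cases hea : e = a
    · subst hea
      have : serveStep p G z S e = insert e S :=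
        if_pos ⟨hsel S hS hSR, by simpa [acceptSet] using he⟩
      exact subset_foldl_serveStep p G z l _ (this ▸ Finset.mem_insert_self e S)
    · obtain ⟨h1, h2⟩ := serveStep_mem hS hSR a
      exact ih (List.mem_of_ne_of_mem hea hl) _ h1 h2

/-- The prices of the accepting selectable agents are collected in every arrival order. -/
theorem sum_selectable_le_worstRevenue (p : N → ℝ≥0) {G : Finset (Finset N)} (hG : ∅ ∈ G)
    (z : N → ℝ≥0) :
    ∑ e, (if e ∈ acceptSet p z ∧ IsSelectableElement G (acceptSet p z) e
      then (p e : ℝ≥0∞) else 0) ≤ worstRevenue p G z := by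
  refine le_iInf fun l => ?_
  rw [← Finset.sum_filter]
  refine Finset.sum_le_sum_of_subset fun e he => ?_
  obtain ⟨h1, h2⟩ := (Finset.mem_filter.1 he).2
  exact mem_foldl_serveStep h1 h2 l.1 (l.2.2 e) ∅ hG (Finset.empty_subset _)

/-- In a down-closed family, the selectability of `e` does not depend on whether `e` is active. -/
theorem IsSelectableElement.of_erase_subset {N : Type*} [DecidableEq N]
    {G : Finset (Finset N)} (hG : IsDownClosed G) {R R' : Finset N} {e : N}
    (hR : R.erase e ⊆ R') (h : IsSelectableElement G R' e) :
    IsSelectableElement G R e := by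
  intro I hI hIR
  have := h (I.erase e) (hG.2 I hI _ (Finset.erase_subset e I))
    ((Finset.erase_subset_erase e hIR).trans hR)
  by_cases he : e ∈ I
  · rwa [Finset.insert_erase he, ← Finset.insert_eq_of_mem he] at this
  · rwa [Finset.erase_eq_of_notMem he] at this

/-- The agents that accept their price, where the price `∞` means that no offer is made. The
argument pairs the valuation and the price of each agent. -/
def activeSet (y : N → ℝ≥0 × ℝ≥0∞) : Finset N :=
  Finset.univ.filter fun e => (y e).2 ≤ (y e).1

/-- The price vector and the family that are posted for prices in `[0, ∞]`: agents with price `∞`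
are removed from the family. -/
def posting (w : (N → ℝ≥0∞) × Finset (Finset N)) : (N → ℝ≥0) × Finset (Finset N) :=
  (fun e => (w.1 e).toNNReal, w.2.filter fun I => ∀ e ∈ I, w.1 e ≠ ∞)

theorem measurable_posting :
    Measurable (posting : (N → ℝ≥0∞) × Finset (Finset N) → (N → ℝ≥0) × Finset (Finset N)) := by
  refine Measurable.prodMk (by fun_prop) ?_
  refine measurable_finset_iff.2 fun I => ?_
  have : (fun w : (N → ℝ≥0∞) × Finset (Finset N) =>
      I ∈ (w.2.filter fun I => ∀ e ∈ I, w.1 e ≠ ∞)) =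
      fun w => I ∈ w.2 ∧ ∀ e ∈ I, w.1 e ≠ ∞ := by
    ext w; simp
  rw [this]
  refine Measurable.and ((measurable_finset_mem I).comp measurable_snd) ?_
  refine Measurable.forall fun e => Measurable.imp measurable_const ?_
  exact measurableSet_setOfPred.1
    ((measurableSet_singleton ∞).compl.preimage ((measurable_pi_apply e).comp measurable_fst))

theorem acceptSet_posting_subset {N : Type*} [Fintype N] {z : N → ℝ≥0} {t : N → ℝ≥0∞} {I : Finset N}
    (ht : ∀ e ∈ I, t e ≠ ∞) (hI : I ⊆ acceptSet (fun e => (t e).toNNReal) z) :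
    I ⊆ activeSet fun e => (z e, t e) := by
  intro e he
  have := hI he
  simp only [acceptSet, activeSet, Finset.mem_filter, Finset.mem_univ, true_and] at this ⊢
  rw [← ENNReal.coe_toNNReal (ht e he)]
  exact_mod_cast this

/-- The revenue of a posting is at least the total price of the active agents that are selectable
with respect to all active agents, in every arrival order. -/
theorem sum_active_le_worstRevenue_posting {G : Finset (Finset N)} (hG : IsDownClosed G)
    (z : N → ℝ≥0) (t : N → ℝ≥0∞) :
    ∑ e, (if t e ≤ z e ∧ IsSelectableElement G (activeSet fun e => (z e, t e)) e
      then t e else 0) ≤ worstRevenue (posting (t, G)).1 (posting (t, G)).2 z := by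
  have hempty : ∅ ∈ (posting (t, G)).2 := by
    obtain ⟨I, hI⟩ := hG.1
    simp only [posting, Finset.mem_filter]
    exact ⟨hG.2 I hI ∅ (Finset.empty_subset I), by simp⟩
  refine le_trans (Finset.sum_le_sum fun e _ => ?_) (sum_selectable_le_worstRevenue _ hempty z)
  by_cases h : t e ≤ z e ∧ IsSelectableElement G (activeSet fun e => (z e, t e)) e
  · have hfin : t e ≠ ∞ := ne_top_of_le_ne_top ENNReal.coe_ne_top h.1
    rw [if_pos h, if_pos]
    · simp [posting, ENNReal.coe_toNNReal hfin]
    refine ⟨?_, fun I hI hIR => ?_⟩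
    · simp only [acceptSet, posting, Finset.mem_filter, Finset.mem_univ, true_and]
      have := h.1
      rw [← ENNReal.coe_toNNReal hfin] at this
      exact_mod_cast this
    · simp only [posting, Finset.mem_filter] at hI ⊢
      refine ⟨h.2 I hI.1 (acceptSet_posting_subset hI.2 hIR), fun i hi => ?_⟩
      rcases Finset.mem_insert.1 hi with rfl | hi
      · exact hfin
      · exact hI.2 i hi
  · rw [if_neg h]
    exact zero_le

theorem measurable_activeSet {N : Type*} [Fintype N] :
    Measurable (activeSet : (N → ℝ≥0 × ℝ≥0∞) → Finset N) := by
  refine measurable_finset_iff.2 fun e => ?_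
  have : (fun y : N → ℝ≥0 × ℝ≥0∞ => e ∈ activeSet y) = fun y => (y e).2 ≤ (y e).1 := by
    ext y; simp [activeSet]
  rw [this]
  exact measurableSet_setOfPred.1 (measurableSet_le (by fun_prop) (by fun_prop))

theorem measure_accept (D : Measure ℝ≥0) [SFinite D] (ν : Measure ℝ≥0∞) [SFinite ν] :
    (D.prod ν) {y | y.2 ≤ (y.1 : ℝ≥0∞)} = saleProb D ν := by
  rw [Measure.prod_apply_symm (measurableSet_le (by fun_prop) (by fun_prop))]
  rfl

/-- The set of active agents has the law of the random set `R(q)` of the contention resolution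
scheme, where `q e` is the probability that agent `e` buys. -/
theorem measure_activeSet_eq (D : N → Measure ℝ≥0) [∀ e, IsProbabilityMeasure (D e)]
    (ν : N → Measure ℝ≥0∞) [∀ e, IsProbabilityMeasure (ν e)] (R : Finset N) :
    Measure.pi (fun e => (D e).prod (ν e)) {y | activeSet y = R} =
      ENNReal.ofReal (activeProb (fun e => (saleProb (D e) (ν e)).toReal) R) := by
  have hA : MeasurableSet {y : ℝ≥0 × ℝ≥0∞ | y.2 ≤ (y.1 : ℝ≥0∞)} :=
    measurableSet_le (by fun_prop) (by fun_prop)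
  have hset : {y : N → ℝ≥0 × ℝ≥0∞ | activeSet y = R} = Set.univ.pi fun e =>
      if e ∈ R then {y : ℝ≥0 × ℝ≥0∞ | y.2 ≤ (y.1 : ℝ≥0∞)} else {y | y.2 ≤ (y.1 : ℝ≥0∞)}ᶜ := by
    ext y
    simp only [Set.mem_ofPred_eq, Set.mem_pi, Set.mem_univ, true_imp_iff, Finset.ext_iff, activeSet,
      Finset.mem_filter, Finset.mem_univ, true_and]
    refine forall_congr' fun e => ?_
    by_cases he : e ∈ R <;> simp [he]
  have hle : ∀ e, saleProb (D e) (ν e) ≤ 1 := fun e => by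
    rw [← measure_accept]; exact prob_le_one
  have hle' : ∀ e, (saleProb (D e) (ν e)).toReal ≤ 1 := fun e =>
    ENNReal.toReal_le_of_le_ofReal zero_le_one (by simpa using hle e)
  rw [hset, Measure.pi_pi, ← Finset.prod_mul_prod_compl R, activeProb,
    ENNReal.ofReal_mul (Finset.prod_nonneg fun _ _ => ENNReal.toReal_nonneg),
    ENNReal.ofReal_prod_of_nonneg (fun _ _ => ENNReal.toReal_nonneg),
    ENNReal.ofReal_prod_of_nonneg (fun e _ => sub_nonneg.2 (hle' e))]
  congr 1
  · refine Finset.prod_congr rfl fun e he => ?_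
    rw [if_pos he, measure_accept, ENNReal.ofReal_toReal
      (ne_top_of_le_ne_top ENNReal.one_ne_top (hle e))]
  · refine Finset.prod_congr rfl fun e he => ?_
    rw [if_neg (Finset.mem_compl.1 he), prob_compl_eq_one_sub hA, measure_accept,
      ENNReal.ofReal_sub _ ENNReal.toReal_nonneg, ENNReal.ofReal_one, ENNReal.ofReal_toReal
      (ne_top_of_le_ne_top ENNReal.one_ne_top (hle e))]

theorem measurable_foldl_serveStep (l : List N)
    {S : (N → ℝ≥0) × ((N → ℝ≥0) × Finset (Finset N)) → Finset N} (hS : Measurable S) :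
    Measurable fun w : (N → ℝ≥0) × ((N → ℝ≥0) × Finset (Finset N)) =>
      l.foldl (serveStep w.2.1 w.2.2 w.1) (S w) := by
  induction l generalizing S with
  | nil => exact hS
  | cons e l ih =>
    -- Maps between the finite types of sets and families are measurable.
    have hins : Measurable fun w => insert e (S w) :=
      (measurable_of_countable fun T : Finset N => insert e T).comp hS
    have hmem : MeasurableSet {w | insert e (S w) ∈ w.2.2} :=
      (hS.prodMk (measurable_snd.comp measurable_snd))
        (MeasurableSet.of_discrete (s := {T : Finset N × Finset (Finset N) | insert e T.1 ∈ T.2}))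
    have hle : MeasurableSet {w : (N → ℝ≥0) × ((N → ℝ≥0) × Finset (Finset N)) |
        w.2.1 e ≤ w.1 e} := measurableSet_le (by fun_prop) (by fun_prop)
    exact ih (Measurable.ite (hmem.inter hle) hins hS)

theorem measurable_worstRevenue :
    Measurable fun w : (N → ℝ≥0) × ((N → ℝ≥0) × Finset (Finset N)) =>
      worstRevenue w.2.1 w.2.2 w.1 := by
  have : Countable (ArrivalOrder N) := Subtype.countable
  refine Measurable.iInf fun l => ?_
  have hserved : Measurable fun w : (N → ℝ≥0) × ((N → ℝ≥0) × Finset (Finset N)) =>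
      served w.2.1 w.2.2 w.1 l.1 := measurable_foldl_serveStep l.1 measurable_const
  have hsum : (fun w : (N → ℝ≥0) × ((N → ℝ≥0) × Finset (Finset N)) =>
      ∑ e ∈ served w.2.1 w.2.2 w.1 l.1, (w.2.1 e : ℝ≥0∞)) =
      fun w => ∑ e, if e ∈ served w.2.1 w.2.2 w.1 l.1 then (w.2.1 e : ℝ≥0∞) else 0 := by
    ext w
    rw [← Finset.sum_filter, Finset.filter_mem_eq_inter, Finset.univ_inter]
  rw [hsum]
  exact Finset.measurable_sum _ fun e _ => Measurable.ite
    (measurableSet_setOfPred.2 ((measurable_finset_mem e).comp hserved)) (by fun_prop)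
    measurable_const

theorem lintegral_pmf_toMeasure {α : Type*} [Fintype α] [MeasurableSpace α]
    [MeasurableSingletonClass α] (p : PMF α) (f : α → ℝ≥0∞) :
    ∫⁻ a, f a ∂p.toMeasure = ∑ a, p a * f a := by
  rw [lintegral_fintype]
  refine Finset.sum_congr rfl fun a _ => ?_
  rw [PMF.toMeasure_apply_singleton _ _ (measurableSet_singleton a), mul_comm]

/-- The payment of an agent with valuation `y.1` that is offered the price `y.2`. -/
def payment (y : ℝ≥0 × ℝ≥0∞) : ℝ≥0∞ := if y.2 ≤ y.1 then y.2 else 0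

theorem measurable_payment : Measurable payment :=
  Measurable.ite (measurableSet_le (by fun_prop) (by fun_prop)) measurable_snd measurable_const

theorem lintegral_payment (D : Measure ℝ≥0) [SFinite D] (ν : Measure ℝ≥0∞) [SFinite ν] :
    ∫⁻ y, payment y ∂(D.prod ν) = saleRevenue D ν := by
  rw [lintegral_prod_symm _ measurable_payment.aemeasurable]
  refine lintegral_congr fun t => ?_
  have hT : MeasurableSet {z : ℝ≥0 | t ≤ z} := measurableSet_le measurable_const (by fun_prop)
  rw [acceptProb, ← lintegral_indicator_const hT t]
  refine lintegral_congr fun z => ?_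
  by_cases h : t ≤ z <;> simp [payment, h]

/-- The probability that `e` is selectable with respect to the active set `R`, over a random
family with law `τ`. -/
def selectProb (τ : PMF (Finset (Finset N))) (e : N) (R : Finset N) : ℝ≥0∞ :=
  ∑ G, τ G * if IsSelectableElement G R e then 1 else 0

theorem selectProb_congr {τ : PMF (Finset (Finset N))} (hτ : ∀ G ∈ τ.support, IsDownClosed G)
    {R R' : Finset N} {e : N} (hR : R.erase e = R'.erase e) :
    selectProb τ e R = selectProb τ e R' := by
  refine Finset.sum_congr rfl fun G _ => ?_
  by_cases hG : G ∈ τ.support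
  · have : IsSelectableElement G R e ↔ IsSelectableElement G R' e :=
      ⟨IsSelectableElement.of_erase_subset (hτ G hG) (hR ▸ Finset.erase_subset e R),
        IsSelectableElement.of_erase_subset (hτ G hG) (hR ▸ Finset.erase_subset e R')⟩
    simp only [this]
  · have : τ G = 0 := by simpa [PMF.mem_support_iff] using hG
    simp [this]

/-- The payment of an agent is independent of the event that the agent is selectable, as the latter
depends on the other agents only. -/
theorem lintegral_payment_mul_selectProb {τ : PMF (Finset (Finset N))}
    (hτ : ∀ G ∈ τ.support, IsDownClosed G)
    (D : N → Measure ℝ≥0) [∀ e, IsProbabilityMeasure (D e)]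
    (ν : N → Measure ℝ≥0∞) [∀ e, IsProbabilityMeasure (ν e)] (e : N) :
    ∫⁻ y, payment (y e) * selectProb τ e (activeSet y) ∂Measure.pi (fun e => (D e).prod (ν e)) =
      saleRevenue (D e) (ν e) *
        ∑ R, selectProb τ e R *
          ENNReal.ofReal (activeProb (fun e => (saleProb (D e) (ν e)).toReal) R) := by
  have hms : Measurable fun y : N → ℝ≥0 × ℝ≥0∞ => selectProb τ e (activeSet y) :=
    (measurable_of_countable (selectProb τ e)).comp measurable_activeSet
  have hmp : Measurable fun y : N → ℝ≥0 × ℝ≥0∞ => payment (y e) :=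
    measurable_payment.comp (measurable_pi_apply e)
  have hupd : ∀ (y : N → ℝ≥0 × ℝ≥0∞) (y' : ℝ≥0 × ℝ≥0∞),
      selectProb τ e (activeSet (Function.update y e y')) = selectProb τ e (activeSet y) := by
    intro y y'
    refine selectProb_congr hτ ?_
    ext i
    by_cases hi : i = e <;> simp [activeSet, hi]
  -- Resampling the agent's own valuation and price separates payment and selectability.
  rw [lintegral_pi_eq_lintegral_update _ e (f := fun y =>
    payment (y e) * selectProb τ e (activeSet y)) (hmp.mul hms)]
  simp only [Function.update_self, hupd]
  have h1 : ∀ y', ∫⁻ y, payment y' * selectProb τ e (activeSet y)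
      ∂Measure.pi (fun e => (D e).prod (ν e)) = payment y' *
        ∫⁻ y, selectProb τ e (activeSet y) ∂Measure.pi (fun e => (D e).prod (ν e)) :=
    fun y' => lintegral_const_mul _ hms
  simp only [h1]
  rw [lintegral_mul_const _ measurable_payment, lintegral_payment]
  congr 1
  rw [← lintegral_map (measurable_of_countable (selectProb τ e)) measurable_activeSet,
    lintegral_fintype]
  refine Finset.sum_congr rfl fun R _ => ?_
  rw [Measure.map_apply measurable_activeSet (measurableSet_singleton R), ← measure_activeSet_eq]
  rfl

theorem ofReal_le_sum_selectProb {τ : PMF (Finset (Finset N))} {q : N → ℝ}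
    (hq : ∀ e, q e ∈ Set.Icc (0 : ℝ) 1) {c : ℝ} {e : N}
    (h : c ≤ ∑ R : Finset N, ∑ G : Finset (Finset N),
      if IsSelectableElement G R e then activeProb q R * (τ G).toReal else 0) :
    ENNReal.ofReal c ≤ ∑ R, selectProb τ e R * ENNReal.ofReal (activeProb q R) := by
  have hnn : ∀ R, 0 ≤ activeProb q R := fun R =>
    mul_nonneg (Finset.prod_nonneg fun e _ => (hq e).1)
      (Finset.prod_nonneg fun e _ => sub_nonneg.2 (hq e).2)
  have hterm : ∀ R G, (0 : ℝ) ≤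
      if IsSelectableElement G R e then activeProb q R * (τ G).toReal else 0 := fun R G => by
    split_ifs
    · exact mul_nonneg (hnn R) ENNReal.toReal_nonneg
    · exact le_rfl
  refine (ENNReal.ofReal_le_ofReal h).trans (le_of_eq ?_)
  rw [ENNReal.ofReal_sum_of_nonneg fun R _ => Finset.sum_nonneg fun G _ => hterm R G]
  refine Finset.sum_congr rfl fun R _ => ?_
  rw [ENNReal.ofReal_sum_of_nonneg fun G _ => hterm R G, selectProb, Finset.sum_mul]
  refine Finset.sum_congr rfl fun G _ => ?_
  split_ifs
  · rw [ENNReal.ofReal_mul (hnn R), ENNReal.ofReal_toReal (τ.apply_ne_top G), mul_one, mul_comm]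
  · simp

/-- Random independent prices and a greedy contention resolution scheme give a posted price
mechanism: if the vector of sale probabilities lies in the relaxation, then the mechanism that
posts these prices together with the family drawn by the scheme keeps a `c`-fraction of the sum of
the single-agent revenues in every arrival order. -/
theorem exists_COPM_of_priceLaws {P : Set (N → ℝ)} (π : GreedyOCRS F P)
    {c : ℝ} (hπ : π.IsSelectable c) (D : N → Measure ℝ≥0) [∀ e, IsProbabilityMeasure (D e)]
    (ν : N → Measure ℝ≥0∞) [∀ e, IsProbabilityMeasure (ν e)]
    (hP : (fun e => (saleProb (D e) (ν e)).toReal) ∈ P) :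
    ∃ C : RandomizedCOPM F,
      ENNReal.ofReal c * ∑ e, saleRevenue (D e) (ν e) ≤ C.expectedRevenue D := by
  set q : N → ℝ := fun e => (saleProb (D e) (ν e)).toReal
  set τ := π.family q
  have hsupp : ∀ᵐ w ∂(Measure.pi ν).prod τ.toMeasure, w.2 ∈ τ.support := by
    refine Measure.quasiMeasurePreserving_snd.ae (p := fun G => G ∈ τ.support) ?_
    rw [ae_iff, PMF.toMeasure_apply_eq_zero_iff _ MeasurableSet.of_discrete]
    exact Set.disjoint_left.2 fun G hG hG' => hG' hG
  let C : RandomizedCOPM F :=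
    { law := ((Measure.pi ν).prod τ.toMeasure).map posting
      isProbabilityMeasure := Measure.isProbabilityMeasure_map measurable_posting.aemeasurable
      subfamily := by
        refine (ae_map_iff measurable_posting.aemeasurable (measurable_snd
          (MeasurableSet.of_discrete (s := {G : Finset (Finset N) | ∅ ∈ G ∧ G ⊆ F})))).2 ?_
        filter_upwards [hsupp] with w hw
        obtain ⟨I, hI⟩ := (π.family_downClosed q hP _ hw).1
        have hempty := (π.family_downClosed q hP _ hw).2 I hI ∅ (Finset.empty_subset I)
        refine ⟨?_, (Finset.filter_subset _ _).trans (π.family_subset q hP _ hw)⟩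
        simp only [posting, Finset.mem_filter]
        exact ⟨hempty, by simp⟩ }
  refine ⟨C, ?_⟩
  have hDC : ∀ G ∈ τ.support, IsDownClosed G := π.family_downClosed q hP
  have hq01 : ∀ e, q e ∈ Set.Icc (0 : ℝ) 1 := fun e => ⟨ENNReal.toReal_nonneg, by
    refine ENNReal.toReal_le_of_le_ofReal zero_le_one ?_
    rw [ENNReal.ofReal_one, ← measure_accept]
    exact prob_le_one⟩
  have hm : ∀ e, Measurable fun y : N → ℝ≥0 × ℝ≥0∞ =>
      payment (y e) * selectProb τ e (activeSet y) := fun e =>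
    (measurable_payment.comp (measurable_pi_apply e)).mul
      ((measurable_of_countable (selectProb τ e)).comp measurable_activeSet)
  have hmW := measurable_worstRevenue (N := N)
  have hpt : ∀ (z : N → ℝ≥0) (t : N → ℝ≥0∞),
      ∑ e, payment (z e, t e) * selectProb τ e (activeSet fun e => (z e, t e)) ≤
        ∫⁻ G, worstRevenue (posting (t, G)).1 (posting (t, G)).2 z ∂τ.toMeasure := by
    intro z t
    rw [lintegral_pmf_toMeasure]
    simp only [selectProb, Finset.mul_sum]
    rw [Finset.sum_comm]
    refine Finset.sum_le_sum fun G _ => ?_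
    by_cases hG : G ∈ τ.support
    · calc _ = τ G * ∑ e, (if t e ≤ z e ∧
            IsSelectableElement G (activeSet fun e => (z e, t e)) e then t e else 0) := by
            rw [Finset.mul_sum]
            refine Finset.sum_congr rfl fun e _ => ?_
            by_cases h1 : t e ≤ z e <;>
              by_cases h2 : IsSelectableElement G (activeSet fun e => (z e, t e)) e <;>
              simp [payment, h1, h2, mul_comm]
        _ ≤ _ := mul_le_mul_right (sum_active_le_worstRevenue_posting (hDC G hG) z t) _
    · have : τ G = 0 := by simpa [PMF.mem_support_iff] using hG
      simp [this]
  calc ENNReal.ofReal c * ∑ e, saleRevenue (D e) (ν e)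
      ≤ ∑ e, ∫⁻ y, payment (y e) * selectProb τ e (activeSet y)
          ∂Measure.pi (fun e => (D e).prod (ν e)) := by
        rw [Finset.mul_sum]
        refine Finset.sum_le_sum fun e _ => ?_
        rw [lintegral_payment_mul_selectProb hDC, mul_comm]
        exact mul_le_mul_right (ofReal_le_sum_selectProb hq01 (hπ q hP e)) _
    _ = ∫⁻ y, ∑ e, payment (y e) * selectProb τ e (activeSet y)
          ∂Measure.pi (fun e => (D e).prod (ν e)) :=
        (lintegral_finsetSum _ fun e _ => hm e).symm
    _ = ∫⁻ w, ∑ e, payment (w.1 e, w.2 e) * selectProb τ e (activeSet fun e => (w.1 e, w.2 e))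
          ∂(Measure.pi D).prod (Measure.pi ν) := by
        rw [← (measurePreserving_arrowProdEquivProdArrow ℝ≥0 ℝ≥0∞ N D ν).lintegral_comp]
        · rfl
        · exact (Finset.measurable_sum _ fun e _ => hm e).comp
            (f := fun w : (N → ℝ≥0) × (N → ℝ≥0∞) => fun e => (w.1 e, w.2 e)) (by fun_prop)
    _ = ∫⁻ z, ∫⁻ t, ∑ e, payment (z e, t e) * selectProb τ e (activeSet fun e => (z e, t e))
          ∂Measure.pi ν ∂Measure.pi D :=
        lintegral_prod _ ((Finset.measurable_sum _ fun e _ => hm e).comp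
            (f := fun w : (N → ℝ≥0) × (N → ℝ≥0∞) => fun e => (w.1 e, w.2 e))
            (by fun_prop)).aemeasurable
    _ ≤ ∫⁻ z, ∫⁻ t, ∫⁻ G, worstRevenue (posting (t, G)).1 (posting (t, G)).2 z ∂τ.toMeasure
          ∂Measure.pi ν ∂Measure.pi D :=
        lintegral_mono fun z => lintegral_mono fun t => hpt z t
    _ = ∫⁻ z, ∫⁻ u, worstRevenue u.1 u.2 z ∂C.law ∂Measure.pi D := by
        refine lintegral_congr fun z => ?_
        have hmz : Measurable fun u : (N → ℝ≥0) × Finset (Finset N) => worstRevenue u.1 u.2 z :=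
          hmW.comp (f := fun u => (z, u)) (by fun_prop)
        rw [lintegral_map hmz measurable_posting]
        exact (lintegral_prod _ (hmz.comp measurable_posting).aemeasurable).symm
    _ = C.expectedRevenue D := by
        have := C.isProbabilityMeasure
        exact (lintegral_prod _ hmW.aemeasurable).symm

/-! ### Optimal random prices for finite means -/

/-- By Carathéodory's theorem, the convex hull is a finite union of continuous images of products of
a simplex with powers of the set. -/
theorem isCompact_convexHull_of_finiteDimensional {E : Type*} [NormedAddCommGroup E]
    [NormedSpace ℝ E] [FiniteDimensional ℝ E] {s : Set E} (hs : IsCompact s) :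
    IsCompact (convexHull ℝ s) := by
  let f : (n : ℕ) → (Fin n → ℝ) × (Fin n → E) → E := fun n w => ∑ i, w.1 i • w.2 i
  have hf : ∀ n, Continuous (f n) := fun n => by fun_prop
  have heq : convexHull ℝ s = ⋃ n ∈ Finset.range (Module.finrank ℝ E + 2),
      f n '' (stdSimplex ℝ (Fin n) ×ˢ Set.univ.pi fun _ => s) := by
    refine Set.Subset.antisymm (fun x hx => ?_) ?_
    · obtain ⟨ι, _, z, w, hz, hind, hw, hw1, rfl⟩ := eq_pos_convex_span_of_mem_convexHull hx
      have hcard : Fintype.card ι < Module.finrank ℝ E + 2 :=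
        Nat.lt_succ_of_le (hind.card_le_finrank_succ.trans
          (Nat.succ_le_succ (Submodule.finrank_le _)))
      simp only [Set.mem_iUnion, Finset.mem_range]
      let σ := (Fintype.equivFin ι).symm
      refine ⟨_, hcard, (w ∘ σ, z ∘ σ), ⟨⟨fun i => (hw _).le, ?_⟩, fun i _ => hz ⟨_, rfl⟩⟩, ?_⟩
      · exact (Equiv.sum_comp σ w).trans hw1
      · exact Equiv.sum_comp σ fun i => w i • z i
    · simp only [Set.iUnion_subset_iff]
      rintro n - _ ⟨⟨w, z⟩, ⟨hw, hz⟩, rfl⟩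
      exact (convex_convexHull ℝ s).sum_mem (fun i _ => hw.1 i) hw.2
        fun i _ => subset_convexHull ℝ s (hz i trivial)
  rw [heq]
  exact Finset.isCompact_biUnion _ fun n _ =>
    ((isCompact_stdSimplex ℝ (Fin n)).prod (isCompact_univ_pi fun _ => hs)).image (hf n)

/-- The pairs of sale probability and revenue that are attained by a fixed price, offered with some
probability. -/
def salePoints (D : Measure ℝ≥0) : Set (ℝ × ℝ) :=
  (fun w : ℝ≥0∞ × ℝ≥0∞ => (w.2.toReal, (w.1 * w.2).toReal)) '' {w | w.2 ≤ acceptProb D w.1}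

/-- The acceptance probability is left-continuous in the price. The bound `s ≤ 1` covers the price
`0`, for which the condition on smaller prices is void. -/
theorem le_acceptProb_of_forall_lt (D : Measure ℝ≥0) [IsProbabilityMeasure D] {s t : ℝ≥0∞}
    (hs : s ≤ 1) (h : ∀ u < t, s ≤ acceptProb D u) : s ≤ acceptProb D t := by
  rcases eq_zero_or_pos t with rfl | ht
  · have : acceptProb D 0 = 1 := by simp [acceptProb]
    rwa [this]
  · obtain ⟨u, hu, hut, hlim⟩ := exists_seq_strictMono_tendsto' ht
    have hset : {z : ℝ≥0 | t ≤ z} = ⋂ n, {z : ℝ≥0 | u n ≤ z} := by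
      ext z
      simp only [Set.mem_ofPred_eq, Set.mem_iInter]
      exact ⟨fun hz n => (hut n).2.le.trans hz, fun hz => le_of_tendsto' hlim hz⟩
    have htend := tendsto_measure_iInter_atTop (μ := D) (s := fun n => {z : ℝ≥0 | u n ≤ z})
      (fun n => (measurableSet_le measurable_const (by fun_prop)).nullMeasurableSet)
      (fun m n hmn z hz => le_trans (hu.monotone hmn) hz) ⟨0, measure_ne_top _ _⟩
    rw [← hset] at htend
    exact ge_of_tendsto' htend fun n => h _ (hut n).2

theorem isClosed_le_acceptProb (D : Measure ℝ≥0) [IsProbabilityMeasure D] :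
    IsClosed {w : ℝ≥0∞ × ℝ≥0∞ | w.2 ≤ acceptProb D w.1} := by
  have heq : {w : ℝ≥0∞ × ℝ≥0∞ | w.2 ≤ acceptProb D w.1} =
      {w | w.2 ≤ 1} ∩ ⋂ u : ℝ≥0∞, ({w | w.1 ≤ u} ∪ {w | w.2 ≤ acceptProb D u}) := by
    ext w
    simp only [Set.mem_ofPred_eq, Set.mem_inter_iff, Set.mem_iInter, Set.mem_union]
    constructor
    · exact fun h => ⟨h.trans (acceptProb_le_one D _), fun u =>
        (le_total w.1 u).imp_right fun hu => h.trans (antitone_acceptProb D hu)⟩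
    · exact fun h => le_acceptProb_of_forall_lt D h.1 fun u hu =>
        (h.2 u).resolve_left (not_le.2 hu)
  rw [heq]
  exact (isClosed_le continuous_snd continuous_const).inter (isClosed_iInter fun u =>
    (isClosed_le continuous_fst continuous_const).union
      (isClosed_le continuous_snd continuous_const))

theorem mul_acceptProb_le (D : Measure ℝ≥0) (t : ℝ≥0∞) :
    t * acceptProb D t ≤ ∫⁻ z in {z : ℝ≥0 | t ≤ z}, (z : ℝ≥0∞) ∂D := by
  rw [acceptProb, ← setLIntegral_const]
  exact setLIntegral_mono' (measurableSet_le measurable_const (by fun_prop)) fun z hz => hz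

theorem mul_acceptProb_le_mean (D : Measure ℝ≥0) (t : ℝ≥0∞) :
    t * acceptProb D t ≤ ∫⁻ z, (z : ℝ≥0∞) ∂D :=
  (mul_acceptProb_le D t).trans (setLIntegral_le_lintegral _ _)

/-- If the mean of the valuation is finite, then the revenue of a price vanishes as the price tends
to infinity. -/
theorem tendsto_tail_mean {D : Measure ℝ≥0} (hD : ∫⁻ z, (z : ℝ≥0∞) ∂D < ∞) :
    Filter.Tendsto (fun t : ℝ≥0∞ => ∫⁻ z in {z : ℝ≥0 | t ≤ z}, (z : ℝ≥0∞) ∂D)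
      (nhds ∞) (nhds 0) := by
  refine tendsto_setLIntegral_zero hD.ne ?_
  have h1 : Filter.Tendsto (fun t : ℝ≥0∞ => (∫⁻ z, (z : ℝ≥0∞) ∂D) * t⁻¹) (nhds ∞) (nhds 0) := by
    have := ENNReal.Tendsto.const_mul (a := ∫⁻ z, (z : ℝ≥0∞) ∂D)
      (continuous_inv.tendsto (∞ : ℝ≥0∞)) (Or.inr hD.ne)
    simpa using this
  refine tendsto_of_tendsto_of_tendsto_of_le_of_le' tendsto_const_nhds h1
    (Filter.Eventually.of_forall fun _ => zero_le) ?_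
  filter_upwards [lt_mem_nhds ENNReal.zero_lt_top] with t ht
  rw [← div_eq_mul_inv, ENNReal.le_div_iff_mul_le (Or.inl ht.ne') (Or.inr hD.ne), mul_comm]
  exact mul_acceptProb_le_mean D t

theorem isCompact_salePoints {D : Measure ℝ≥0} [IsProbabilityMeasure D]
    (hD : ∫⁻ z, (z : ℝ≥0∞) ∂D < ∞) : IsCompact (salePoints D) := by
  refine (isClosed_le_acceptProb D).isCompact.image_of_continuousOn fun w hw => ?_
  have hw1 : w.2 ≠ ∞ := ne_top_of_le_ne_top ENNReal.one_ne_top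
    (le_trans hw (acceptProb_le_one D _))
  have hmul : ContinuousWithinAt (fun w : ℝ≥0∞ × ℝ≥0∞ => w.1 * w.2)
      {w | w.2 ≤ acceptProb D w.1} w := by
    -- On this set, the product can be discontinuous at `(∞, 0)` only, where the tail of
    -- the mean bounds it.
    by_cases htop : w.1 = ∞
    · have h0 : w.2 = 0 := by
        have : w.2 ≤ acceptProb D w.1 := hw
        rwa [htop, acceptProb_top, nonpos_iff_eq_zero] at this
      rw [ContinuousWithinAt, h0, mul_zero]
      have hfst : Filter.Tendsto (fun w : ℝ≥0∞ × ℝ≥0∞ => w.1)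
          (nhdsWithin w {w | w.2 ≤ acceptProb D w.1}) (nhds ∞) :=
        htop ▸ (continuous_fst.tendsto w).mono_left nhdsWithin_le_nhds
      refine tendsto_of_tendsto_of_tendsto_of_le_of_le' tendsto_const_nhds
        ((tendsto_tail_mean hD).comp hfst) (Filter.Eventually.of_forall fun _ => zero_le) ?_
      filter_upwards [self_mem_nhdsWithin] with v hv
      exact (mul_le_mul_right hv _).trans (mul_acceptProb_le D v.1)
    · exact (ENNReal.Tendsto.mul (continuous_fst.tendsto w) (Or.inr hw1)
        (continuous_snd.tendsto w) (Or.inr htop)).mono_left nhdsWithin_le_nhds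
  have hfin : w.1 * w.2 ≠ ∞ := ne_top_of_le_ne_top hD.ne
    ((mul_le_mul_right hw _).trans (mul_acceptProb_le_mean D _))
  exact ((ENNReal.tendsto_toReal hw1).comp
      ((continuous_snd.tendsto w).mono_left nhdsWithin_le_nhds)).prodMk_nhds
    ((ENNReal.tendsto_toReal hfin).comp hmul)

theorem zero_mem_salePoints (D : Measure ℝ≥0) : (0 : ℝ × ℝ) ∈ salePoints D :=
  ⟨(0, 0), show (0 : ℝ≥0∞) ≤ acceptProb D 0 from zero_le, by simp⟩

/-- Every convex combination of sale points is attained by a random price. -/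
theorem exists_priceLaw_of_mem_convexHull {D : Measure ℝ≥0} [IsProbabilityMeasure D]
    {k : ℝ × ℝ} (hk : k ∈ convexHull ℝ (salePoints D)) :
    ∃ ν : Measure ℝ≥0∞, IsProbabilityMeasure ν ∧ saleProb D ν = ENNReal.ofReal k.1 ∧
      saleRevenue D ν = ENNReal.ofReal k.2 ∧ 0 ≤ k.1 ∧ 0 ≤ k.2 := by
  refine convexHull_min (t := {k : ℝ × ℝ | ∃ ν : Measure ℝ≥0∞, IsProbabilityMeasure ν ∧
    saleProb D ν = ENNReal.ofReal k.1 ∧ saleRevenue D ν = ENNReal.ofReal k.2 ∧ 0 ≤ k.1 ∧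
      0 ≤ k.2}) ?_ ?_ hk
  · rintro _ ⟨⟨t, s⟩, hs, rfl⟩
    change s ≤ acceptProb D t at hs
    -- Offering the price `t` with probability `a` sells with probability `s`.
    let a : ℝ≥0∞ := s / acceptProb D t
    have ha1 : a ≤ 1 := ENNReal.div_le_of_le_mul (by simpa using hs)
    have ha : a * acceptProb D t = s := by
      by_cases h0 : acceptProb D t = 0
      · rw [h0, mul_zero]
        exact (le_antisymm (h0 ▸ hs) zero_le).symm
      · exact ENNReal.div_mul_cancel h0 (measure_ne_top _ _)
    have hsfin : s ≠ ∞ := ne_top_of_le_ne_top ENNReal.one_ne_top (hs.trans (acceptProb_le_one D t))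
    have hts : t * s ≠ ∞ := by
      by_cases ht : t = ∞
      · have : s = 0 := by rwa [ht, acceptProb_top, nonpos_iff_eq_zero] at hs
        simp [this]
      · exact ENNReal.mul_ne_top ht hsfin
    refine ⟨a • Measure.dirac t + (1 - a) • Measure.dirac ∞, ⟨?_⟩, ?_, ?_,
      ENNReal.toReal_nonneg, ENNReal.toReal_nonneg⟩
    · simp [add_tsub_cancel_of_le ha1]
    · simp [saleProb, acceptProb_top, ha, ENNReal.ofReal_toReal hsfin]
    · simp only [saleRevenue, lintegral_add_measure, lintegral_smul_measure, lintegral_dirac,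
        acceptProb_top, mul_zero, add_zero, smul_eq_mul]
      rw [mul_left_comm, ha, ENNReal.ofReal_toReal hts]
  · rintro k ⟨ν, hν, h1, h2, hk1, hk2⟩ k' ⟨ν', hν', h1', h2', hk1', hk2'⟩ a b ha hb hab
    refine ⟨ENNReal.ofReal a • ν + ENNReal.ofReal b • ν', ⟨?_⟩, ?_, ?_, ?_, ?_⟩
    · simp [← ENNReal.ofReal_add ha hb, hab]
    · rw [saleProb, lintegral_add_measure, lintegral_smul_measure, lintegral_smul_measure,
        ← saleProb, ← saleProb, h1, h1', smul_eq_mul, smul_eq_mul, ← ENNReal.ofReal_mul ha,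
        ← ENNReal.ofReal_mul hb, ← ENNReal.ofReal_add (by positivity) (by positivity)]
      rfl
    · rw [saleRevenue, lintegral_add_measure, lintegral_smul_measure, lintegral_smul_measure,
        ← saleRevenue, ← saleRevenue, h2, h2', smul_eq_mul, smul_eq_mul, ← ENNReal.ofReal_mul ha,
        ← ENNReal.ofReal_mul hb, ← ENNReal.ofReal_add (by positivity) (by positivity)]
      rfl
    · exact add_nonneg (mul_nonneg ha hk1) (mul_nonneg hb hk1')
    · exact add_nonneg (mul_nonneg ha hk2) (mul_nonneg hb hk2')

theorem saleRevenue_le_mean (D : Measure ℝ≥0) (ν : Measure ℝ≥0∞) [IsProbabilityMeasure ν] :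
    saleRevenue D ν ≤ ∫⁻ z, (z : ℝ≥0∞) ∂D := by
  calc saleRevenue D ν ≤ ∫⁻ _, (∫⁻ z, (z : ℝ≥0∞) ∂D) ∂ν :=
        lintegral_mono fun t => mul_acceptProb_le_mean D t
    _ = _ := by simp

/-- The outcome of a random price is the mean of sale points. -/
theorem mem_convexHull_salePoints {D : Measure ℝ≥0} [IsProbabilityMeasure D]
    (hD : ∫⁻ z, (z : ℝ≥0∞) ∂D < ∞) (ν : Measure ℝ≥0∞) [IsProbabilityMeasure ν] :
    ((saleProb D ν).toReal, (saleRevenue D ν).toReal) ∈ convexHull ℝ (salePoints D) := by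
  have hm : Measurable fun t => t * acceptProb D t := measurable_id.mul (measurable_acceptProb D)
  have hsale : saleProb D ν ≠ ∞ := by
    refine ne_top_of_le_ne_top ENNReal.one_ne_top ?_
    calc saleProb D ν ≤ ∫⁻ _, 1 ∂ν := lintegral_mono fun t => acceptProb_le_one D t
      _ = 1 := by simp
  have hrev : saleRevenue D ν ≠ ∞ := ne_top_of_le_ne_top hD.ne (saleRevenue_le_mean D ν)
  have hi1 : Integrable (fun t => (acceptProb D t).toReal) ν :=
    integrable_toReal_of_lintegral_ne_top (measurable_acceptProb D).aemeasurable hsale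
  have hi2 : Integrable (fun t => (t * acceptProb D t).toReal) ν :=
    integrable_toReal_of_lintegral_ne_top hm.aemeasurable hrev
  have hmem := (convex_convexHull ℝ (salePoints D)).integral_mem
    (isCompact_convexHull_of_finiteDimensional (isCompact_salePoints hD)).isClosed
    (Filter.Eventually.of_forall fun t : ℝ≥0∞ => subset_convexHull ℝ _
      ⟨(t, acceptProb D t), show acceptProb D t ≤ acceptProb D t from le_rfl, rfl⟩) (hi1.prodMk hi2)
  rwa [integral_pair hi1 hi2, integral_toReal (measurable_acceptProb D).aemeasurable
    (ae_of_all _ fun t => (acceptProb_le_one D t).trans_lt ENNReal.one_lt_top),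
    integral_toReal hm.aemeasurable
    (ae_of_all _ fun t => (mul_acceptProb_le_mean D t).trans_lt hD)] at hmem

/-- If all valuations have finite means, then some random prices maximize the sum of the
single-agent revenues among those whose sale probabilities lie in the convex hull of the feasible
sets. -/
theorem exists_optimal_priceLaws (hF : IsDownClosed F) (D : N → Measure ℝ≥0)
    [∀ e, IsProbabilityMeasure (D e)] (hD : ∀ e, ∫⁻ z, (z : ℝ≥0∞) ∂(D e) < ∞) :
    ∃ ν : N → Measure ℝ≥0∞, (∀ e, IsProbabilityMeasure (ν e)) ∧
      (fun e => (saleProb (D e) (ν e)).toReal) ∈ feasiblePolytope F ∧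
      ∀ ν' : N → Measure ℝ≥0∞, (∀ e, IsProbabilityMeasure (ν' e)) →
        (fun e => (saleProb (D e) (ν' e)).toReal) ∈ feasiblePolytope F →
        ∑ e, saleRevenue (D e) (ν' e) ≤ ∑ e, saleRevenue (D e) (ν e) := by
  let T : Set (N → ℝ × ℝ) := (Set.univ.pi fun e => convexHull ℝ (salePoints (D e))) ∩
    {k | (fun e => (k e).1) ∈ feasiblePolytope F}
  have hclosed : IsClosed (feasiblePolytope F) :=
    (((Finset.finite_toSet F).image charVec).isCompact_convexHull ℝ).isClosed
  have hT : IsCompact T :=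
    (isCompact_univ_pi fun e => isCompact_convexHull_of_finiteDimensional
      (isCompact_salePoints (hD e))).inter_right (hclosed.preimage (by fun_prop))
  have hne : T.Nonempty := by
    obtain ⟨I, hI⟩ := hF.1
    refine ⟨0, fun e _ => subset_convexHull ℝ _ (zero_mem_salePoints (D e)),
      subset_convexHull ℝ _ ⟨∅, hF.2 I hI ∅ (Finset.empty_subset I), ?_⟩⟩
    ext e
    simp [charVec]
  obtain ⟨k, ⟨hkT, hkF⟩, hmax⟩ := hT.exists_isMaxOn hne
    (f := fun k => ∑ e, (k e).2) (Continuous.continuousOn (by fun_prop))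
  choose ν hν h1 h2 hk1 hk2 using fun e => exists_priceLaw_of_mem_convexHull (hkT e trivial)
  refine ⟨ν, hν, ?_, fun ν' hν' hF' => ?_⟩
  · simp only [h1, ENNReal.toReal_ofReal (hk1 _)]
    exact hkF
  · have hle := hmax (show (fun e => ((saleProb (D e) (ν' e)).toReal,
      (saleRevenue (D e) (ν' e)).toReal)) ∈ T from
      ⟨fun e _ => mem_convexHull_salePoints (hD e) (ν' e), hF'⟩)
    have hfin : ∀ e, saleRevenue (D e) (ν' e) ≠ ∞ := fun e =>
      ne_top_of_le_ne_top (hD e).ne (saleRevenue_le_mean _ _)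
    calc ∑ e, saleRevenue (D e) (ν' e)
        = ENNReal.ofReal (∑ e, (saleRevenue (D e) (ν' e)).toReal) := by
          rw [ENNReal.ofReal_sum_of_nonneg fun _ _ => ENNReal.toReal_nonneg]
          simp only [ENNReal.ofReal_toReal (hfin _)]
      _ ≤ ENNReal.ofReal (∑ e, (k e).2) := ENNReal.ofReal_le_ofReal hle
      _ = ∑ e, saleRevenue (D e) (ν e) := by
          rw [ENNReal.ofReal_sum_of_nonneg fun e _ => hk2 e]
          simp only [h2]

theorem feasiblePolytope_subset {N : Type*} [DecidableEq N] {F : Finset (Finset N)}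
    {P : Set (N → ℝ)} (hP : IsRelaxation F P) :
    feasiblePolytope F ⊆ P := by
  obtain ⟨V, -, hV⟩ := hP.isPolytope
  refine convexHull_min ?_ (hV ▸ convex_convexHull ℝ V)
  rintro _ ⟨S, hS, rfl⟩
  have h01 : charVec S ∈ {x : N → ℝ | ∀ e, x e = 0 ∨ x e = 1} := fun e => by
    by_cases h : e ∈ S <;> simp [charVec, h]
  have hmem : charVec S ∈ feasiblePolytope F ∩ {x : N → ℝ | ∀ e, x e = 0 ∨ x e = 1} :=
    ⟨subset_convexHull ℝ _ ⟨S, hS, rfl⟩, h01⟩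
  rw [← hP.zero_one_points] at hmem
  exact hmem.1

/-- The revenue of a truthful mechanism is at most the sum of the revenues of random prices whose
sale probabilities form a convex combination of feasible sets. -/
theorem Mechanism.IsTruthful.exists_priceLaws {M : Mechanism F} (hM : M.IsTruthful)
    (D : N → Measure ℝ≥0) [∀ e, IsProbabilityMeasure (D e)] :
    ∃ ν : N → Measure ℝ≥0∞, (∀ e, IsProbabilityMeasure (ν e)) ∧
      (fun e => (saleProb (D e) (ν e)).toReal) ∈ feasiblePolytope F ∧
      M.expectedRevenue D ≤ ((∑ e, saleRevenue (D e) (ν e) : ℝ≥0∞) : EReal) := by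
  choose ν hν hsale hrev using fun e => hM.exists_priceLaw D e
  refine ⟨ν, hν, ?_, (M.expectedRevenue_le_sum D).trans ?_⟩
  · simpa only [hsale] using M.expectedServeProb_mem D
  · exact EReal.coe_ennreal_le_coe_ennreal_iff.2 (Finset.sum_le_sum fun e _ => hrev e)

theorem coe_mul_le_coe_ennreal {c : ℝ} (hc : 0 ≤ c) {x : EReal} {y z : ℝ≥0∞}
    (hx : x ≤ (y : EReal)) (hyz : ENNReal.ofReal c * y ≤ z) : (c : EReal) * x ≤ (z : EReal) := by
  calc (c : EReal) * x ≤ c * (y : EReal) := mul_le_mul_of_nonneg_left hx (EReal.coe_nonneg.2 hc)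
    _ = ((ENNReal.ofReal c * y : ℝ≥0∞) : EReal) := by
        rw [EReal.coe_ennreal_mul, EReal.coe_ennreal_ofReal, max_eq_left hc]
    _ ≤ z := EReal.coe_ennreal_le_coe_ennreal_iff.2 hyz

end

end Pricing

theorem mainTheorem8 {N : Type*} [Fintype N] [DecidableEq N]
    (F : Finset (Finset N)) (hF : Pricing.IsDownClosed F)
    (P : Set (N → ℝ)) (hP : Pricing.IsRelaxation F P)
    (c : ℝ) (hc : c ∈ Set.Icc (0 : ℝ) 1)
    (π : Pricing.GreedyOCRS F P) (hπ : π.IsSelectable c)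
    (D : N → Measure ℝ≥0) [∀ e, IsProbabilityMeasure (D e)] :
    (∀ M : Pricing.Mechanism F, M.IsTruthful →
      ∃ C : Pricing.RandomizedCOPM F,
        (c : EReal) * M.expectedRevenue D ≤ (C.expectedRevenue D : EReal)) ∧
    ((∀ e, ∫⁻ z, (z : ℝ≥0∞) ∂(D e) < ∞) →
      ∃ C : Pricing.RandomizedCOPM F, ∀ M : Pricing.Mechanism F, M.IsTruthful →
        (c : EReal) * M.expectedRevenue D ≤ (C.expectedRevenue D : EReal)) := by
  refine ⟨fun M hM => ?_, fun hD => ?_⟩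
  · obtain ⟨ν, hν, hq, hrev⟩ := hM.exists_priceLaws D
    obtain ⟨C, hC⟩ := Pricing.exists_COPM_of_priceLaws π hπ D ν
      (Pricing.feasiblePolytope_subset hP hq)
    exact ⟨C, Pricing.coe_mul_le_coe_ennreal hc.1 hrev hC⟩
  · obtain ⟨ν, hν, hq, hopt⟩ := Pricing.exists_optimal_priceLaws hF D hD
    obtain ⟨C, hC⟩ := Pricing.exists_COPM_of_priceLaws π hπ D ν
      (Pricing.feasiblePolytope_subset hP hq)
    refine ⟨C, fun M hM => ?_⟩
    obtain ⟨ν', hν', hq', hrev⟩ := hM.exists_priceLaws D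
    exact Pricing.coe_mul_le_coe_ennreal hc.1
      (hrev.trans (EReal.coe_ennreal_le_coe_ennreal_iff.2 (hopt ν' hν' hq'))) hC
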